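/- Let $q$ be an odd prime power with $q\equiv 3\pmod{10}$, and put $n=\frac{q^2+1}{10}$, $r=q+1$, $s=\frac{q^2+1}{2}$. Let $1\le\lambda\le\frac{q-3}{10}$. Let $\alpha\in\mathbb F_{q^2}^*$ be a primitive $r$-th root of unity and let $\delta$ be a primitive $rn$-th root of unity in an extension field of $\mathbb F_{q^2}$ with $\delta^n=\alpha$. For an integer $i$ let $C_i=\{iq^{2j} \bmod rn : j\in\mathbb Z\}$ be the $q^2$-cyclotomic coset of $i$ modulo $rn$. An $\alpha$-constacyclic code of length $n$ over $\mathbb F_{q^2}$ with monic generator polynomial $g\mid x^n-\alpha$ has defining set $\{i\in\{1+rj \bmod rn: 0\le j\le n-1\}: g(\delta^i)=0\}$. Let $$Z=\bigcup_{j=0}^{\frac{3(q-3)}{10}+\lambda}C_{s-rj},\qquad -qZ=\{-qz \bmod rn: z\in Z\},$$ $$k=n-\tfrac65(q-3)-4\lambda+3,\qquad d=\tfrac35(q-3)+2\lambda+2 .$$ Then: 1. $Z\cap(-qZ)=C_s\cup C_{s-r\frac{3q+1}{10}}\cup C_{s-r\frac{q-3}{10}}$. 2. There is an $\alpha$-constacyclic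 code $\mathcal C$ of length $n$ over $\mathbb F_{q^2}$ with defining set $Z$. Every such $\mathcal C$ has minimum Hamming distance $d$ and dimension $K$ with $2K-n+5=k$, and each parity check matrix $H$ of $\mathcal C$ satisfies $\operatorname{rank}(HH^{*})=5$, where $H^{*}$ is the transpose of the matrix obtained from $H$ by raising all entries to the $q$-th power. 3. There exists an entanglement-assisted quantum error-correcting code with parameters $$[[\,n,\;n-\tfrac65(q-3)-4\lambda+3,\;\tfrac35(q-3)+2\lambda+2;\;5\,]]_q ,$$ that is, an isometry $V:(\mathbb C^q)^{\otimes k}\otimes(\mathbb C^q)^{\otimes 5}\to(\mathbb C^q)^{\otimes n}$, which the sender applies to $k$ information qudits and to her halves of $5$ maximally entangled pairs, the receiver's halves being free of errors, such that $d$ is exactly the least number of transmitted qudits on which an undetectable error acts. It attains equality in the entanglement-assisted Singleton bound, $n+5-k=2(d-1)$, and $d\le\frac{n+2}{2}$ unless $q=13$; thus it is an EAQMDS code (for $q=13$ in the sense of the equality only, where $n=17$ and $d=10$). -/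

import Mathlib

open Polynomial
open scoped Matrix

noncomputable section

namespace EAQ

/-! ### Cyclotomic cosets, constacyclic codes and their defining sets -/

/-- The `q²`-cyclotomic coset of `i` modulo `N`. (When `q` is a unit modulo `N`, nonnegative
exponents give the same set as all integer exponents.) -/
def cyclotomicCoset (q N : ℕ) (i : ZMod N) : Set (ZMod N) :=
  {x | ∃ j : ℕ, x = i * ((q : ZMod N) ^ 2) ^ j}

/-- The set `-qZ` modulo `N`. -/
def negMul (q N : ℕ) (Z : Set (ZMod N)) : Set (ZMod N) :=
  {x | ∃ z ∈ Z, x = -(q : ZMod N) * z}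

/-- The set `O_{rn} = {1 + r j | 0 ≤ j ≤ n - 1}` of exponents of the roots of `X ^ n - α`. -/
def rootExponents (r n : ℕ) : Set (ZMod (r * n)) :=
  {x | ∃ j : ℕ, j < n ∧ x = 1 + (r : ZMod (r * n)) * (j : ZMod (r * n))}

/-- The constacyclic shift `(c₀, …, cₙ₋₁) ↦ (α cₙ₋₁, c₀, …, cₙ₋₂)`. -/
def constaShift {F : Type*} [Field F] {n : ℕ} (α : F) (c : Fin n → F) : Fin n → F :=
  fun i => if (i : ℕ) = 0 then α * c ⟨(n - 1 : ℕ), by have := i.2; omega⟩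
    else c ⟨(i : ℕ) - 1, by have := i.2; omega⟩

/-- A linear code closed under the `α`-constacyclic shift. -/
def IsConstacyclic {F : Type*} [Field F] {n : ℕ} (α : F) (C : Submodule F (Fin n → F)) : Prop :=
  ∀ c ∈ C, constaShift α c ∈ C

/-- The polynomial `c₀ + c₁ X + ⋯ + cₙ₋₁ X ^ (n - 1)` of a word. -/
def wordPoly {F : Type*} [Field F] {n : ℕ} (c : Fin n → F) : F[X] :=
  ∑ i : Fin n, Polynomial.C (c i) * X ^ (i : ℕ)

/-- `g` is the monic divisor of `X ^ n - α` that generates `C`, seen as an ideal of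
`F[X] / (X ^ n - α)`. -/
def IsGeneratorPoly {F : Type*} [Field F] {n : ℕ} (α : F) (C : Submodule F (Fin n → F))
    (g : F[X]) : Prop :=
  g.Monic ∧ g ∣ X ^ n - Polynomial.C α ∧
    ∀ c : Fin n → F, c ∈ C ↔
      Ideal.Quotient.mk (Ideal.span {X ^ n - Polynomial.C α}) (wordPoly c) ∈
        Ideal.span {Ideal.Quotient.mk (Ideal.span {X ^ n - Polynomial.C α}) g}

/-- The exponents `i ∈ O_{rn}` for which `δ ^ i` is a root of `g`. -/
def rootSet {F K : Type*} [Field F] [Field K] [Algebra F K] (r n : ℕ) (δ : K) (g : F[X]) :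
    Set (ZMod (r * n)) :=
  {i | i ∈ rootExponents r n ∧ Polynomial.aeval (δ ^ i.val) g = 0}

/-- `C` is an `α`-constacyclic code of length `n` with defining set `Z` with respect to the
`rn`-th root of unity `δ`. -/
def IsConstacyclicWithDefiningSet {F K : Type*} [Field F] [Field K] [Algebra F K] (r n : ℕ)
    (δ : K) (α : F) (C : Submodule F (Fin n → F)) (Z : Set (ZMod (r * n))) : Prop :=
  IsConstacyclic α C ∧ ∃ g : F[X], IsGeneratorPoly α C g ∧ rootSet r n δ g = Z

/-- `C` has minimum Hamming distance exactly `d`. -/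
def HasMinDist {F : Type*} [Field F] [DecidableEq F] {n : ℕ} (C : Submodule F (Fin n → F))
    (d : ℕ) : Prop :=
  IsLeast {w | ∃ c ∈ C, c ≠ 0 ∧ hammingNorm c = w} d

/-- `H` is a parity check matrix of `C`. -/
def IsParityCheck {F : Type*} [Field F] {m n : ℕ} (H : Matrix (Fin m) (Fin n) F)
    (C : Submodule F (Fin n → F)) : Prop :=
  LinearIndependent F H.row ∧ ∀ c : Fin n → F, c ∈ C ↔ H *ᵥ c = 0

/-- The conjugate transpose over the field with `q²` elements, for the conjugation `x ↦ x ^ q`. -/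
def conjTransposeQ {F : Type*} [Field F] {m n : ℕ} (q : ℕ) (H : Matrix (Fin m) (Fin n) F) :
    Matrix (Fin n) (Fin m) F :=
  (H.map (fun x => x ^ q))ᵀ

/-! ### Entanglement-assisted quantum error-correcting codes

A register of `n` qudits has the computational basis `Fin n → Fin q`; its state vectors are the
functions `(Fin n → Fin q) → ℂ`. -/

/-- The basis labels of `n` qudits of dimension `q`. -/
abbrev Labels (q n : ℕ) : Type := Fin n → Fin q

/-- `c` maximally entangled pairs of qudits, `q ^ (-c/2) ∑_b |b⟩ ⊗ |b⟩`; the first half belongs to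
the sender, the second half to the receiver. -/
def ebits (q c : ℕ) (p : Labels q c × Labels q c) : ℂ :=
  if p.1 = p.2 then ((Real.sqrt ((q : ℝ) ^ c) : ℝ) : ℂ)⁻¹ else 0

/-- The encoded state `(V ⊗ I) (ψ ⊗ ebits)`: the sender applies `V` to `k` information qudits and
to her halves of the `c` entangled pairs, the receiver's halves are untouched. -/
def encode {q n k c : ℕ} (V : Matrix (Labels q n) (Labels q k × Labels q c) ℂ)
    (ψ : Labels q k → ℂ) : Labels q n × Labels q c → ℂ :=
  fun p => ∑ x : Labels q k, ∑ b : Labels q c, V p.1 (x, b) * (ψ x * ebits q c (b, p.2))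

/-- `E ⊗ I` for an operator `E` on the `n` transmitted qudits. -/
def applyError {q n c : ℕ} (E : Matrix (Labels q n) (Labels q n) ℂ)
    (v : Labels q n × Labels q c → ℂ) : Labels q n × Labels q c → ℂ :=
  fun p => ∑ a : Labels q n, E p.1 a * v (a, p.2)

/-- `E` is of the form `M ⊗ I` with `M` an operator on the qudits in `S`. -/
def ActsOn {q n : ℕ} (E : Matrix (Labels q n) (Labels q n) ℂ) (S : Finset (Fin n)) : Prop :=
  ∃ M : Matrix (S → Fin q) (S → Fin q) ℂ, ∀ a a' : Labels q n,
    E a a' = if ∀ i : Fin n, i ∉ S → a i = a' i then M (fun i => a i) (fun i => a' i) else 0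

/-- The Knill–Laflamme condition: `P (E ⊗ I) P = μ P` for the projection `P` onto the space of
encoded states. -/
def Detects {q n k c : ℕ} (V : Matrix (Labels q n) (Labels q k × Labels q c) ℂ)
    (E : Matrix (Labels q n) (Labels q n) ℂ) : Prop :=
  ∃ μ : ℂ, ∀ φ ψ : Labels q k → ℂ,
    star (encode V φ) ⬝ᵥ applyError E (encode V ψ) = μ * (star (encode V φ) ⬝ᵥ encode V ψ)

/-- `V` encodes an entanglement-assisted quantum code with parameters `⟦n, k, d; c⟧_q`: it is an
isometry (a unitary on `n` qudits, of which `n - k - c` start as ancillas in a fixed state), and `d`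
is the minimum distance, that is the least number of transmitted qudits on which some undetectable
error acts. The receiver's halves of the entangled pairs are free of errors. -/
structure IsEAQECC (q n k d c : ℕ) (V : Matrix (Labels q n) (Labels q k × Labels q c) ℂ) :
    Prop where
  isometry : Vᴴ * V = 1
  minDist : IsLeast {w | ∃ (S : Finset (Fin n)) (E : Matrix (Labels q n) (Labels q n) ℂ),
    S.card = w ∧ ActsOn E S ∧ ¬ Detects V E} d

/-- There is an entanglement-assisted quantum code with parameters `⟦n, k, d; c⟧_q`. -/
def ExistsEAQECC (q n k d c : ℕ) : Prop :=
  ∃ V : Matrix (Labels q n) (Labels q k × Labels q c) ℂ, IsEAQECC q n k d c V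

end EAQ

end

/-! Write `q = 10m + 3`, so that `n = 10m² + 6m + 1`, `10n = q² + 1` and `s = 5n`, and put `b = 3m +
l`. The exponent `s + rj` depends only on `j` modulo `n`. Since `q² ≡ -1` modulo `n` and `sr ≡ 0`
modulo `rn`, multiplication by `q²` sends `j` to `-j`, and multiplication by `-q` sends `j` to
`-qj`. Hence `Z` is the set of exponents with `|j| ≤ b`, and `Z ∩ (-qZ)` is governed by the
solutions of `qi ≡ j` modulo `n` in the square `|i|, |j| ≤ b`. There are exactly five
(`dvd_mul_sub_iff`).

The polynomial `g` whose roots are the `δ ^ (s + rj)` with `|j| ≤ b` is fixed by the square of the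
`q`-Frobenius, so it is defined over `F`, and it generates the only code with defining set `Z`. Its
`2b + 1` consecutive roots give distance at least `2b + 2` by the BCH bound. The degree of `g` caps
the weight of every `X ^ i * g` at the same number, so the code is spanned by words of minimum
weight. Over `K`, the Gram matrix `HH*` is equivalent to the matrix of geometric sums `∑ (ρᵢ ρⱼ ^ q)
^ t`, which is `n` times a partial permutation matrix; its five nonzero entries are the five
solutions above, so the rank is 5 (`rank_gram`, `rank_partialPerm`).

The quantum code is built by representation theory (`exists_EAQECC_of_code`). Let `D` be the
Hermitian dual of `C` and `R = C ∩ D`. Orthonormal families `u` and `v` complement `R` in `C` and in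
`D`; they have `k` and `c = rank HH*` members. Vectors of `F ^ n` index Weyl operators on `n`
qudits, and averaging gives an isometry that turns the operators of the `u i` and `v j` into Weyl
operators on the information qudits and on the sender's halves of the entangled pairs, while `R`
acts trivially (`IsWeyl.exists_isometry`). A Weyl error outside `C` fails to commute with an
operator from `R` or from the span of `v`, so its compression has partial trace zero and it is
detected. A word of `C` outside `R` acts as a non-scalar operator on the information. Thus the
distance is the minimum weight in `C`, provided that some minimum-weight word lies outside `R`; the
spanning property supplies one. -/

noncomputable section

namespace EAQ

/-! ### The defining set -/

/-- The exponent `s + r j` modulo `r n`. -/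
def expo (r n s : ℕ) (j : ℤ) : ZMod (r * n) := (s : ZMod (r * n)) + (r : ZMod (r * n)) * (j : ZMod (r * n))

theorem expo_eq_intCast (r n s : ℕ) (j : ℤ) :
    expo r n s j = (((s : ℤ) + (r : ℤ) * j : ℤ) : ZMod (r * n)) := by
  simp [expo]

theorem expo_eq_expo_iff {r n s : ℕ} (hr : 0 < r) (i j : ℤ) :
    expo r n s i = expo r n s j ↔ (n : ℤ) ∣ j - i := by
  rw [expo_eq_intCast, expo_eq_intCast, ZMod.intCast_eq_intCast_iff_dvd_sub]
  have : (s : ℤ) + r * j - (s + r * i) = r * (j - i) := by ring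
  rw [this, Nat.cast_mul]
  exact mul_dvd_mul_iff_left (by exact_mod_cast hr.ne')

section DefiningSet

variable {q n r s m l : ℕ}

/-- Modulo `rn` one has `s(q² - 1) = 5n(q - 1)r ≡ 0`, and `r(q² + 1) = 10rn ≡ 0` turns `rj q²` into
`-rj`. -/
theorem expo_mul_sq (hq : q = 10 * m + 3) (hn : n = 10 * m ^ 2 + 6 * m + 1) (hr : r = q + 1)
    (hs : s = 5 * n) (j : ℤ) : expo r n s j * (q : ZMod (r * n)) ^ 2 = expo r n s (-j) := by
  have h : (((s : ℤ) + r * j) * (q : ℤ) ^ 2 : ℤ) - ((s : ℤ) + r * (-j)) =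
      ((r * n : ℕ) : ℤ) * (5 * (q - 1) + 10 * j) := by
    subst hs hr hq; push_cast; rw [hn]; push_cast; ring
  rw [expo_eq_intCast, expo_eq_intCast]
  have : (((s : ℤ) + r * j : ℤ) : ZMod (r * n)) * (q : ZMod (r * n)) ^ 2 =
      ((((s : ℤ) + r * j) * (q : ℤ) ^ 2 : ℤ) : ZMod (r * n)) := by push_cast; ring
  rw [this, eq_comm, ZMod.intCast_eq_intCast_iff_dvd_sub]
  exact ⟨_, h⟩

/-- The multiple `sr = 5nr` vanishes modulo `rn`, so `-q` fixes `s`. -/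
theorem neg_mul_expo (hr : r = q + 1) (hs : s = 5 * n) (j : ℤ) :
    -(q : ZMod (r * n)) * expo r n s j = expo r n s (-(q * j)) := by
  have h : (-(q : ℤ) * ((s : ℤ) + r * j)) - ((s : ℤ) + r * (-(q * j))) =
      ((r * n : ℕ) : ℤ) * (-5) := by
    subst hs hr; push_cast; ring
  rw [expo_eq_intCast, expo_eq_intCast]
  have : -(q : ZMod (r * n)) * (((s : ℤ) + r * j : ℤ) : ZMod (r * n)) =
      ((-(q : ℤ) * ((s : ℤ) + r * j) : ℤ) : ZMod (r * n)) := by push_cast; ring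
  rw [this, eq_comm, ZMod.intCast_eq_intCast_iff_dvd_sub]
  exact ⟨_, h⟩

theorem cyclotomicCoset_expo (hq : q = 10 * m + 3) (hn : n = 10 * m ^ 2 + 6 * m + 1)
    (hr : r = q + 1) (hs : s = 5 * n) (j : ℤ) :
    cyclotomicCoset q (r * n) (expo r n s j) = {expo r n s j, expo r n s (-j)} := by
  ext x
  simp only [cyclotomicCoset, Set.mem_ofPred_eq, Set.mem_insert_iff, Set.mem_singleton_iff]
  constructor
  · rintro ⟨t, rfl⟩
    induction t with
    | zero => simp
    | succ t ih =>
      rw [pow_succ, ← mul_assoc]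
      rcases ih with h | h
      · rw [h, expo_mul_sq hq hn hr hs]; simp
      · rw [h, expo_mul_sq hq hn hr hs]; simp
  · rintro (rfl | rfl)
    · exact ⟨0, by simp⟩
    · exact ⟨1, by rw [pow_one, expo_mul_sq hq hn hr hs]⟩

theorem expo_mem_rootExponents (hq : q = 10 * m + 3) (hn : n = 10 * m ^ 2 + 6 * m + 1)
    (hr : r = q + 1) (hs : s = 5 * n) (j : ℤ) : expo r n s j ∈ rootExponents r n := by
  have hn0 : (0 : ℤ) < n := by rw [hn]; positivity
  -- The shift comes from `s = 1 + r(5m + 1)`.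
  refine ⟨((5 * m + 1 + j) % n).toNat, ?_, ?_⟩
  · have := Int.emod_lt_of_pos (5 * m + 1 + j) hn0
    have := Int.emod_nonneg (5 * m + 1 + j) hn0.ne'
    omega
  · have h0 := Int.emod_nonneg (5 * m + 1 + j) hn0.ne'
    have h1 : ((((5 * m + 1 + j) % n).toNat : ℕ) : ZMod (r * n)) =
        (((5 * m + 1 + j) % n : ℤ) : ZMod (r * n)) := by
      conv_rhs => rw [← Int.toNat_of_nonneg h0, Int.cast_natCast]
    have h2 : (1 : ZMod (r * n)) + (r : ZMod (r * n)) * (((5 * m + 1 + j) % n : ℤ) : ZMod (r * n))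
      = ((1 + r * ((5 * m + 1 + j) % n) : ℤ) : ZMod (r * n)) := by push_cast; ring
    rw [h1, h2, expo_eq_intCast, ZMod.intCast_eq_intCast_iff_dvd_sub]
    refine ⟨-((5 * m + 1 + j) / n), ?_⟩
    have h3 := Int.emod_add_mul_ediv (5 * m + 1 + j) n
    have h4 : (s : ℤ) = 1 + r * (5 * m + 1) := by
      subst hs hr hq; push_cast; rw [hn]; push_cast; ring
    rw [h4]; push_cast
    linear_combination (r : ℤ) * h3

/-- The only solutions of `q i ≡ j` modulo `n` in the interval `[-(3m+l), 3m+l]`. -/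
theorem dvd_mul_sub_iff (hq : q = 10 * m + 3) (hn : n = 10 * m ^ 2 + 6 * m + 1)
    (hl : 1 ≤ l) (hl' : l ≤ m) (i j : ℤ) (hi : |i| ≤ 3 * m + l) (hj : |j| ≤ 3 * m + l) :
    (n : ℤ) ∣ q * i - j ↔ (i = 0 ∧ j = 0) ∨ (i = m ∧ j = -(3 * m + 1)) ∨
      (i = -m ∧ j = 3 * m + 1) ∨ (i = 3 * m + 1 ∧ j = m) ∨ (i = -(3 * m + 1) ∧ j = -m) := by
  rw [abs_le] at hi hj
  have hqz : (q : ℤ) = 10 * m + 3 := by rw [hq]; push_cast; ring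
  have hnz : (n : ℤ) = 10 * m ^ 2 + 6 * m + 1 := by rw [hn]; push_cast; ring
  have hlz : (l : ℤ) ≤ m := by exact_mod_cast hl'
  have hlz1 : (1 : ℤ) ≤ l := by exact_mod_cast hl
  constructor
  · rintro ⟨t, ht⟩
    rw [hqz, hnz] at ht
    -- Since `l ≤ m`, both `|i|` and `|j|` are at most `4m`, so `|qi - j| ≤ 4m(q + 1) < 4n`.
    have ht1 : t ≤ 3 := by
      by_contra! h
      nlinarith
    have ht2 : -3 ≤ t := by
      by_contra! h
      nlinarith
    -- As `n = qm + (3m + 1)`, the substitution `i = tm + u` gives `j = qu - t(3m + 1)`. With `|j| ≤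
    -- 4m` and `|t| ≤ 3` this forces `|u| ≤ 1`, leaving 21 pairs `(t, u)`.
    obtain ⟨u, rfl⟩ : ∃ u, i = t * (m : ℤ) + u := ⟨i - t * m, by ring⟩
    have hu : j = (10 * (m : ℤ) + 3) * u - 3 * t * m - t := by linear_combination -ht
    clear hqz hnz hq hn
    have hu1 : u ≤ 1 := by
      by_contra! h
      nlinarith
    have hu2 : -1 ≤ u := by
      by_contra! h
      nlinarith
    interval_cases t <;> interval_cases u <;> omega
  · rw [hqz, hnz]
    rintro (⟨rfl, rfl⟩ | ⟨rfl, rfl⟩ | ⟨rfl, rfl⟩ | ⟨rfl, rfl⟩ | ⟨rfl, rfl⟩)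
    · simp
    · exact ⟨1, by ring⟩
    · exact ⟨-1, by ring⟩
    · exact ⟨3, by ring⟩
    · exact ⟨-3, by ring⟩

theorem iUnion_cyclotomicCoset (hq : q = 10 * m + 3) (hn : n = 10 * m ^ 2 + 6 * m + 1)
    (hr : r = q + 1) (hs : s = 5 * n) (b : ℕ) :
    ⋃ j ∈ Finset.Icc 0 b, cyclotomicCoset q (r * n) (expo r n s (-(j : ℤ))) =
      expo r n s '' Set.Icc (-(b : ℤ)) b := by
  ext x
  simp only [cyclotomicCoset_expo hq hn hr hs, Set.mem_iUnion, Set.mem_image, Set.mem_Icc,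
    Finset.mem_Icc, Set.mem_insert_iff, Set.mem_singleton_iff, exists_prop, neg_neg]
  constructor
  · rintro ⟨j, hj, rfl | rfl⟩
    · exact ⟨-j, by omega, rfl⟩
    · exact ⟨j, by omega, rfl⟩
  · rintro ⟨j, hj, rfl⟩
    refine ⟨j.natAbs, by omega, ?_⟩
    rcases Int.natAbs_eq j with h | h
    · right; rw [← h]
    · left; rw [← h]

/-- An exponent with index `j` lies in `-qZ` exactly when `qi ≡ -j` modulo `n` for some `|i| ≤ b`,
so the five solutions of `dvd_mul_sub_iff` give the indices `0`, `±(3m + 1)`, `±m`. The bound `1 ≤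
l` keeps `3m + 1` within range. -/
theorem image_inter_negMul (hq : q = 10 * m + 3) (hn : n = 10 * m ^ 2 + 6 * m + 1)
    (hr : r = q + 1) (hs : s = 5 * n) (hl : 1 ≤ l) (hl' : l ≤ m) :
    expo r n s '' Set.Icc (-((3 * m + l : ℕ) : ℤ)) (3 * m + l : ℕ) ∩
      negMul q (r * n) (expo r n s '' Set.Icc (-((3 * m + l : ℕ) : ℤ)) (3 * m + l : ℕ)) =
    cyclotomicCoset q (r * n) (expo r n s (-((0 : ℕ) : ℤ))) ∪
      cyclotomicCoset q (r * n) (expo r n s (-((3 * m + 1 : ℕ) : ℤ))) ∪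
      cyclotomicCoset q (r * n) (expo r n s (-(m : ℤ))) := by
  have hr0 : 0 < r := by omega
  ext x
  simp only [cyclotomicCoset_expo hq hn hr hs, Set.mem_inter_iff, negMul, Set.mem_ofPred_eq,
    Set.mem_union, Set.mem_insert_iff, Set.mem_singleton_iff, neg_neg]
  constructor
  · rintro ⟨⟨j, hj, rfl⟩, z, ⟨i, hi, rfl⟩, h⟩
    rw [neg_mul_expo hr hs, expo_eq_expo_iff hr0] at h
    rw [Set.mem_Icc] at hi hj
    have h' : (n : ℤ) ∣ q * i - (-j) := by
      obtain ⟨t, ht⟩ := h; exact ⟨-t, by linear_combination -ht⟩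
    rw [dvd_mul_sub_iff hq hn hl hl' i (-j) (by rw [abs_le]; push_cast at *; omega)
      (by rw [abs_le]; push_cast at *; omega)] at h'
    rcases h' with ⟨_, h'⟩ | ⟨_, h'⟩ | ⟨_, h'⟩ | ⟨_, h'⟩ | ⟨_, h'⟩
    · obtain rfl : j = 0 := by omega
      simp
    · obtain rfl : j = (3 * m + 1 : ℕ) := by push_cast; omega
      simp
    · obtain rfl : j = -((3 * m + 1 : ℕ) : ℤ) := by push_cast; omega
      simp
    · obtain rfl : j = -(m : ℤ) := by omega
      simp
    · obtain rfl : j = m := by omega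
      simp
  · have key : ∀ i j : ℤ, |i| ≤ 3 * m + l → |j| ≤ 3 * m + l → (n : ℤ) ∣ q * i - (-j) →
        (∃ x ∈ Set.Icc (-((3 * m + l : ℕ) : ℤ)) (3 * m + l : ℕ), expo r n s x = expo r n s j) ∧
        ∃ z ∈ expo r n s '' Set.Icc (-((3 * m + l : ℕ) : ℤ)) (3 * m + l : ℕ),
          expo r n s j = -(q : ZMod (r * n)) * z := by
      intro i j hi hj h
      rw [abs_le] at hi hj
      refine ⟨⟨j, by rw [Set.mem_Icc]; push_cast; omega, rfl⟩, _,
        ⟨i, by rw [Set.mem_Icc]; push_cast; omega, rfl⟩, ?_⟩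
      rw [neg_mul_expo hr hs, expo_eq_expo_iff hr0]
      obtain ⟨t, ht⟩ := h
      exact ⟨-t, by linear_combination -ht⟩
    have key' : ∀ i j : ℤ, |i| ≤ 3 * m + l → |j| ≤ 3 * m + l →
        ((i = 0 ∧ -j = 0) ∨ (i = m ∧ -j = -(3 * m + 1)) ∨
      (i = -m ∧ -j = 3 * m + 1) ∨ (i = 3 * m + 1 ∧ -j = m) ∨ (i = -(3 * m + 1) ∧ -j = -m)) → _ :=
      fun i j hi hj h => key i j hi hj
        ((dvd_mul_sub_iff hq hn hl hl' i (-j) hi (by rwa [abs_neg])).2 h)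
    rintro (((rfl | rfl) | (rfl | rfl)) | (rfl | rfl))
    · exact key' 0 _ (by rw [abs_le]; omega) (by rw [abs_le]; omega) (by simp)
    · exact key' 0 _ (by rw [abs_le]; omega) (by rw [abs_le]; omega) (by simp)
    · exact key' (-m) _ (by rw [abs_le]; omega) (by rw [abs_le]; omega) (by simp)
    · exact key' m _ (by rw [abs_le]; omega) (by rw [abs_le]; omega) (by simp)
    · exact key' (3 * m + 1) _ (by rw [abs_le]; omega) (by rw [abs_le]; omega) (by simp)
    · exact key' (-(3 * m + 1)) _ (by rw [abs_le]; omega) (by rw [abs_le]; omega) (by simp)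

end DefiningSet

/-! ### The Hermitian form over a quadratic extension of finite fields -/

/-- `x ↦ x ^ q` is an additive involution of `F`, in odd characteristic. -/
structure IsConj (F : Type*) [Field F] (q : ℕ) : Prop where
  add_pow : ∀ x y : F, (x + y) ^ q = x ^ q + y ^ q
  pow_pow : ∀ x : F, (x ^ q) ^ q = x
  ne_zero : q ≠ 0

section Hermitian

variable {F : Type*} [Field F] {q : ℕ} {ι : Type*} [Fintype ι]

theorem IsConj.neg_pow (h : IsConj F q) (x : F) : (-x) ^ q = -x ^ q := by
  have := h.add_pow x (-x)
  rw [add_neg_cancel, zero_pow h.ne_zero] at this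
  linear_combination -this

theorem IsConj.sub_pow (h : IsConj F q) (x y : F) : (x - y) ^ q = x ^ q - y ^ q := by
  rw [sub_eq_add_neg, h.add_pow, h.neg_pow, sub_eq_add_neg]

theorem IsConj.sum_pow (h : IsConj F q) {σ : Type*} (s : Finset σ) (f : σ → F) :
    (∑ i ∈ s, f i) ^ q = ∑ i ∈ s, f i ^ q := by
  classical
  induction s using Finset.induction_on with
  | empty => simp [zero_pow h.ne_zero]
  | insert a s ha ih => rw [Finset.sum_insert ha, Finset.sum_insert ha, h.add_pow, ih]

/-- The Hermitian form `∑ xᵢ yᵢ ^ q`. -/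
def herm (q : ℕ) (x y : ι → F) : F := ∑ i, x i * y i ^ q

theorem herm_add_left (x y z : ι → F) : herm q (x + y) z = herm q x z + herm q y z := by
  simp [herm, add_mul, Finset.sum_add_distrib]

theorem herm_smul_left (a : F) (x y : ι → F) : herm q (a • x) y = a * herm q x y := by
  simp [herm, Finset.mul_sum, mul_assoc]

theorem herm_sum_left {σ : Type*} (s : Finset σ) (f : σ → ι → F) (y : ι → F) :
    herm q (∑ i ∈ s, f i) y = ∑ i ∈ s, herm q (f i) y := by
  simp only [herm, Finset.sum_apply, Finset.sum_mul]
  exact Finset.sum_comm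

theorem herm_zero_left (y : ι → F) : herm q 0 y = 0 := by simp [herm]

theorem herm_neg_left (x y : ι → F) : herm q (-x) y = -herm q x y := by simp [herm]

theorem herm_sub_left (x y z : ι → F) : herm q (x - y) z = herm q x z - herm q y z := by
  rw [sub_eq_add_neg, herm_add_left, herm_neg_left, sub_eq_add_neg]

theorem herm_swap (h : IsConj F q) (x y : ι → F) : herm q y x = herm q x y ^ q := by
  rw [herm, herm, h.sum_pow]
  exact Finset.sum_congr rfl fun i _ => by rw [mul_pow, h.pow_pow, mul_comm]

theorem herm_eq_zero_swap (h : IsConj F q) {x y : ι → F} (hxy : herm q x y = 0) :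
    herm q y x = 0 := by
  rw [herm_swap h, hxy, zero_pow h.ne_zero]

theorem herm_add_right (h : IsConj F q) (x y z : ι → F) :
    herm q x (y + z) = herm q x y + herm q x z := by
  rw [herm_swap h, herm_add_left, h.add_pow, ← herm_swap h, ← herm_swap h]

theorem herm_neg_right (h : IsConj F q) (x y : ι → F) : herm q x (-y) = -herm q x y := by
  rw [herm_swap h, herm_neg_left, h.neg_pow, ← herm_swap h]

theorem herm_zero_right (h : IsConj F q) (x : ι → F) : herm q x 0 = 0 :=
  herm_eq_zero_swap h (herm_zero_left x)

theorem herm_smul_right (h : IsConj F q) (a : F) (x y : ι → F) :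
    herm q x (a • y) = a ^ q * herm q x y := by
  rw [herm_swap h, herm_smul_left, mul_pow, ← herm_swap h]

theorem herm_sum_right (h : IsConj F q) {σ : Type*} (s : Finset σ) (x : ι → F) (f : σ → ι → F) :
    herm q x (∑ i ∈ s, f i) = ∑ i ∈ s, herm q x (f i) := by
  rw [herm_swap h, herm_sum_left, h.sum_pow]
  exact Finset.sum_congr rfl fun i _ => (herm_swap h _ _).symm

theorem herm_single_right [DecidableEq ι] (h : IsConj F q) (x : ι → F) (i : ι) (a : F) :
    herm q x (Pi.single i a) = x i * a ^ q := by
  rw [herm, Finset.sum_eq_single i]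
  · simp
  · intro j _ hj; simp [hj, zero_pow h.ne_zero]
  · simp

theorem herm_single_left [DecidableEq ι] (x : ι → F) (i : ι) (a : F) :
    herm q (Pi.single i a) x = a * x i ^ q := by
  rw [herm, Finset.sum_eq_single i]
  · simp
  · intro j _ hj; simp [hj]
  · simp

theorem eq_zero_of_herm_eq_zero (h : IsConj F q) (x : ι → F) (hx : ∀ y, herm q x y = 0) :
    x = 0 := by
  classical
  ext i
  simpa [herm_single_right h] using hx (Pi.single i 1)

end Hermitian

/-! ### Weyl operators -/

/-- An additive character whose composition with the Hermitian form is a multiplier of Weyl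
operators. -/
structure IsHermChar {F : Type*} [Field F] (q : ℕ) (χ : AddChar F ℂ) : Prop where
  star_eq : ∀ x, star (χ x) = χ (-x)
  conj : ∀ x, χ (x ^ q) = χ (-x)
  self : ∀ x, χ (x * x ^ q) = 1
  nondeg : ∀ x ≠ 0, ∃ y, χ (x * y ^ q) ≠ χ (y * x ^ q)

/-- A family of operators on `ℂ ^ L`, indexed by the vectors of a Hermitian space, that satisfies
the Weyl relations. -/
structure IsWeyl {F ι L : Type*} [Field F] [Fintype ι] [Fintype L] [DecidableEq L] (q : ℕ)
    (χ : AddChar F ℂ) (W : (ι → F) → Matrix L L ℂ) : Prop where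
  zero : W 0 = 1
  mul : ∀ e f, W e * W f = χ (herm q e f) • W (e + f)
  conjTranspose : ∀ e, (W e)ᴴ = W (-e)

section Weyl

variable {F : Type*} [Field F] {q : ℕ} {ι κ L L' : Type*} [Fintype ι] [Fintype κ]
  [Fintype L] [DecidableEq L] [Fintype L'] [DecidableEq L'] {χ : AddChar F ℂ}
  {W : (ι → F) → Matrix L L ℂ} {W' : (κ → F) → Matrix L' L' ℂ}

theorem IsHermChar.herm_self (hχ : IsHermChar q χ) (e : ι → F) : χ (herm q e e) = 1 := by
  classical
  have (s : Finset ι) : χ (∑ i ∈ s, e i * e i ^ q) = 1 := by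
    induction s using Finset.induction_on with
    | empty => simp
    | insert a s ha ih => rw [Finset.sum_insert ha, AddChar.map_add_eq_mul, hχ.self, ih, one_mul]
  exact this _

theorem IsHermChar.herm_swap (hF : IsConj F q) (hχ : IsHermChar q χ) (e f : ι → F) :
    χ (herm q f e) = χ (-herm q e f) := by
  rw [EAQ.herm_swap hF, hχ.conj]

theorem IsWeyl.op_mul_neg (hF : IsConj F q) (hχ : IsHermChar q χ) (hW : IsWeyl q χ W) (e : ι → F) :
    W e * W (-e) = 1 := by
  rw [hW.mul, herm_neg_right hF, AddChar.map_neg_eq_inv, hχ.herm_self, add_neg_cancel, hW.zero]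
  simp

theorem IsWeyl.op_neg_mul (hχ : IsHermChar q χ) (hW : IsWeyl q χ W) (e : ι → F) :
    W (-e) * W e = 1 := by
  rw [hW.mul, herm_neg_left, AddChar.map_neg_eq_inv, hχ.herm_self, neg_add_cancel, hW.zero]
  simp

/-- The two orders of multiplication differ by `χ(h(e,f)) / χ(h(f,e))`, and conjugate symmetry makes
the denominator the inverse of the numerator. -/
theorem IsWeyl.op_mul_comm (hF : IsConj F q) (hχ : IsHermChar q χ) (hW : IsWeyl q χ W)
    (e f : ι → F) : W e * W f = χ (herm q e f + herm q e f) • (W f * W e) := by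
  rw [hW.mul, hW.mul, hχ.herm_swap hF e f, smul_smul, ← AddChar.map_add_eq_mul, add_comm f e]
  congr 2; ring

theorem IsHermChar.exists_herm_ne_one (hF : IsConj F q) (hχ : IsHermChar q χ) (e : ι → F)
    (he : e ≠ 0) : ∃ f, χ (herm q e f + herm q e f) ≠ 1 := by
  classical
  obtain ⟨i, hi⟩ := Function.ne_iff.1 he
  obtain ⟨y, hy⟩ := hχ.nondeg (e i) hi
  refine ⟨Pi.single i y, fun h => hy ?_⟩
  rw [← herm_single_right hF, ← herm_single_left, hχ.herm_swap hF e, AddChar.map_neg_eq_inv]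
  rw [AddChar.map_add_eq_mul] at h
  exact eq_inv_of_mul_eq_one_left h

/-- Conjugation by a suitable `W f` multiplies `W e` by a scalar other than 1 but preserves the
trace. -/
theorem IsWeyl.trace_eq_zero (hF : IsConj F q) (hχ : IsHermChar q χ) (hW : IsWeyl q χ W)
    (e : ι → F) (he : e ≠ 0) : (W e).trace = 0 := by
  obtain ⟨f, hf⟩ := hχ.exists_herm_ne_one hF e he
  have h : (W e).trace = χ (herm q e f + herm q e f) * (W e).trace := by
    calc (W e).trace = (W e * W f * W (-f)).trace := by
          rw [mul_assoc, hW.op_mul_neg hF hχ, mul_one]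
      _ = χ (herm q e f + herm q e f) * (W f * W e * W (-f)).trace := by
          rw [hW.op_mul_comm hF hχ, Matrix.smul_mul, Matrix.trace_smul, smul_eq_mul]
      _ = _ := by rw [Matrix.trace_mul_comm, ← mul_assoc, hW.op_neg_mul hχ, one_mul]
  by_contra h0
  exact hf (mul_right_cancel₀ h0 (by rw [← h, one_mul]))

/-- The Weyl operators are orthogonal for the trace form, by `trace_eq_zero`. -/
theorem IsWeyl.linearIndependent [Fintype F] [DecidableEq ι] [Nonempty L] (hF : IsConj F q)
    (hχ : IsHermChar q χ) (hW : IsWeyl q χ W) : LinearIndependent ℂ W := by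
  rw [Fintype.linearIndependent_iff]
  intro g hg e
  have h : (W (-e) * ∑ f, g f • W f).trace = g e * Fintype.card L := by
    rw [Finset.mul_sum, Matrix.trace_sum, Finset.sum_eq_single e]
    · rw [Matrix.mul_smul, hW.op_neg_mul hχ, Matrix.trace_smul, Matrix.trace_one, smul_eq_mul]
    · intro f _ hf
      rw [Matrix.mul_smul, hW.mul, Matrix.trace_smul, Matrix.trace_smul,
        hW.trace_eq_zero hF hχ]
      · simp
      · intro h0
        exact hf (neg_add_eq_zero.1 h0).symm
    · simp
  rw [hg, mul_zero, Matrix.trace_zero, eq_comm, mul_eq_zero] at h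
  exact h.resolve_right (by exact_mod_cast Fintype.card_ne_zero)

theorem IsWeyl.span_eq_top [Fintype F] [DecidableEq ι] [Nonempty L] (hF : IsConj F q)
    (hχ : IsHermChar q χ) (hW : IsWeyl q χ W)
    (hcard : Fintype.card (ι → F) = Fintype.card L ^ 2) :
    Submodule.span ℂ (Set.range W) = ⊤ := by
  refine (hW.linearIndependent hF hχ).span_eq_top_of_card_eq_finrank' ?_
  rw [hcard, Module.finrank_matrix, Module.finrank_self, mul_one, sq]

/-- Irreducibility: when there are as many Weyl operators as the dimension of the matrix algebra,
they span it, and its centre is the scalars. -/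
theorem IsWeyl.exists_eq_smul_one [Fintype F] [DecidableEq ι] [Nonempty L] (hF : IsConj F q)
    (hχ : IsHermChar q χ) (hW : IsWeyl q χ W)
    (hcard : Fintype.card (ι → F) = Fintype.card L ^ 2) (M : Matrix L L ℂ)
    (hM : ∀ e, M * W e = W e * M) : ∃ z : ℂ, M = z • 1 := by
  have h : ∀ N : Matrix L L ℂ, M * N = N * M := by
    intro N
    have hN : N ∈ Submodule.span ℂ (Set.range W) := by
      rw [hW.span_eq_top hF hχ hcard]; trivial
    induction hN using Submodule.span_induction with
    | mem x hx => obtain ⟨e, rfl⟩ := hx; exact hM e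
    | zero => simp
    | add x y _ _ hx hy => rw [mul_add, add_mul, hx, hy]
    | smul a x _ hx => rw [Matrix.mul_smul, Matrix.smul_mul, hx]
  obtain ⟨z, hz⟩ := Matrix.mem_range_scalar_iff_commute_single'.2 fun i j => (h _).symm
  refine ⟨z, ?_⟩
  rw [← hz, Matrix.smul_one_eq_diagonal]; rfl

open scoped ComplexOrder in
/-- A Hermitian isometry `κ → F` into `ι → F` whose image is orthogonal to an isotropic subgroup `R`
is implemented by an isometry of the spaces of states, with image fixed by the operators of `R`. -/
theorem IsWeyl.exists_isometry [Fintype F] [DecidableEq ι] [DecidableEq κ] [Nonempty L]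
    [Nonempty L'] (hF : IsConj F q) (hχ : IsHermChar q χ) (hW : IsWeyl q χ W)
    (hW' : IsWeyl q χ W') (hcard : Fintype.card (κ → F) = Fintype.card L' ^ 2)
    (R : AddSubgroup (ι → F)) (φ : (κ → F) →+ (ι → F))
    (hφ : ∀ f g, herm q (φ f) (φ g) = herm q f g)
    (hR : ∀ x ∈ R, ∀ y ∈ R, herm q x y = 0) (hRφ : ∀ x ∈ R, ∀ f, herm q x (φ f) = 0) :
    ∃ V : Matrix L L' ℂ, Vᴴ * V = 1 ∧ ∀ x ∈ R, ∀ f, W (x + φ f) * V = V * W' f := by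
  classical
  -- If two sums agree, `φ (f - g)` lies in `R` and is therefore orthogonal to the image of `φ`.
  -- Because `φ` preserves the nondegenerate form, `f = g`.
  have hinj : Function.Injective fun p : R × (κ → F) => (p.1 : ι → F) + φ p.2 := by
    rintro ⟨⟨x, hx⟩, f⟩ ⟨⟨y, hy⟩, g⟩ h
    simp only at h
    have h1 : φ (f - g) = y - x := by
      rw [map_sub, sub_eq_sub_iff_add_eq_add, add_comm, h, add_comm]
    have h2 : f - g = 0 := by
      refine eq_zero_of_herm_eq_zero hF _ fun z => ?_
      rw [← hφ, h1]
      exact hRφ _ (R.sub_mem hy hx) z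
    have h3 : f = g := sub_eq_zero.1 h2
    subst h3
    simpa using h
  have hli := (hW.linearIndependent hF hχ).comp _ hinj
  -- Averaging over the group `R × (κ → F)`: every `T X` intertwines the two actions, because the
  -- phases from `W` and `W'` agree and `R` contributes none.
  let T : Matrix L L' ℂ → Matrix L L' ℂ := fun X =>
    ∑ p : R × (κ → F), W ((p.1 : ι → F) + φ p.2) * X * W' (-p.2)
  have hT : ∀ X, ∀ x ∈ R, ∀ f, W (x + φ f) * T X = T X * W' f := by
    intro X x hx f
    simp only [T, Matrix.mul_sum, Matrix.sum_mul]
    refine Fintype.sum_equiv (Equiv.addLeft ((⟨x, hx⟩ : R), f)) _ _ ?_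
    rintro ⟨⟨y, hy⟩, g⟩
    simp only [Equiv.coe_addLeft, Prod.mk_add_mk, AddMemClass.mk_add_mk]
    have e1 : W (x + φ f) * (W (y + φ g) * X * W' (-g)) =
        χ (herm q f g) • (W (x + y + φ (f + g)) * X * W' (-g)) := by
      rw [← Matrix.mul_assoc, ← Matrix.mul_assoc, hW.mul, Matrix.smul_mul, Matrix.smul_mul]
      congr 3
      · rw [herm_add_left, herm_add_right hF, herm_add_right hF, hR x hx y hy, hRφ x hx,
          herm_eq_zero_swap hF (hRφ y hy f), hφ]
        simp
      · rw [map_add]; abel_nf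
    have e2 : W (x + y + φ (f + g)) * X * W' (-(f + g)) * W' f =
        χ (herm q f g) • (W (x + y + φ (f + g)) * X * W' (-g)) := by
      rw [Matrix.mul_assoc, hW'.mul, Matrix.mul_smul]
      congr 1
      · rw [herm_neg_left, herm_add_left, neg_add, AddChar.map_add_eq_mul, AddChar.map_neg_eq_inv,
          hχ.herm_self, inv_one, one_mul, ← hχ.herm_swap hF]
      · congr 2; abel
    rw [e1, e2]
  -- If `T` killed every matrix unit, the diagonal entries `W' (-f) b b` would be coefficients of a
  -- linear relation among independent Weyl operators. The coefficient at `f = 0` is 1.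
  obtain ⟨X, hX⟩ : ∃ X, T X ≠ 0 := by
    by_contra! h
    obtain ⟨b⟩ := ‹Nonempty L'›
    have key : ∀ p : R × (κ → F), W' (-p.2) b b = 0 := by
      refine Fintype.linearIndependent_iff.1 hli (fun p => W' (-p.2) b b) ?_
      ext a a'
      have := congrFun (congrFun (h (Matrix.single a' b 1)) a) b
      simp only [T] at this
      rw [Matrix.zero_apply, Matrix.sum_apply] at this
      rw [Matrix.zero_apply, Matrix.sum_apply, ← this]
      refine Finset.sum_congr rfl fun p _ => ?_
      rw [Matrix.mul_assoc, Matrix.mul_apply, Finset.sum_eq_single a']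
      · simp [mul_comm]
      · intro c _ hc; rw [Matrix.single_mul_apply_of_ne _ _ _ _ _ hc, mul_zero]
      · simp
    have := key 0
    rw [Prod.snd_zero, neg_zero, hW'.zero, Matrix.one_apply_eq] at this
    exact one_ne_zero this
  set V := T X with hV
  -- By Schur's lemma `Vᴴ * V` is a scalar, so a nonzero intertwiner is an isometry up to scaling.
  obtain ⟨z, hz⟩ := hW'.exists_eq_smul_one hF hχ hcard (Vᴴ * V) fun f => by
    have h1 := hT X 0 R.zero_mem f
    have h2 := congrArg Matrix.conjTranspose (hT X 0 R.zero_mem (-f))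
    rw [Matrix.conjTranspose_mul, Matrix.conjTranspose_mul, hW.conjTranspose, hW'.conjTranspose,
      zero_add, map_neg, neg_neg, neg_neg] at h2
    rw [zero_add] at h1
    rw [Matrix.mul_assoc, ← h1, ← Matrix.mul_assoc, h2, Matrix.mul_assoc]
  have hz0 : z ≠ 0 := by
    rintro rfl
    rw [zero_smul, Matrix.conjTranspose_mul_self_eq_zero] at hz
    exact hX hz
  obtain ⟨b⟩ := ‹Nonempty L'›
  obtain ⟨t, ht0, ht⟩ : ∃ t : ℝ, 0 ≤ t ∧ (t : ℂ) = z := by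
    refine ⟨∑ a, ‖V a b‖ ^ 2, by positivity, ?_⟩
    have := congrFun (congrFun hz b) b
    rw [Matrix.mul_apply, Matrix.smul_apply, Matrix.one_apply_eq, smul_eq_mul, mul_one] at this
    rw [← this]; push_cast
    refine Finset.sum_congr rfl fun a _ => ?_
    rw [Matrix.conjTranspose_apply, ← Complex.conj_mul']; rfl
  have hs : ((Real.sqrt t : ℝ) : ℂ) * ((Real.sqrt t : ℝ) : ℂ) = z := by
    rw [← Complex.ofReal_mul, Real.mul_self_sqrt ht0, ht]
  refine ⟨((Real.sqrt t : ℝ) : ℂ)⁻¹ • V, ?_, fun x hx f => ?_⟩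
  · rw [Matrix.conjTranspose_smul, Matrix.smul_mul, Matrix.mul_smul, hz, smul_smul, smul_smul,
      ← hs]
    have : ((Real.sqrt t : ℝ) : ℂ) ≠ 0 := by
      intro h; rw [h, zero_mul] at hs; exact hz0 hs.symm
    rw [← Complex.ofReal_inv, Complex.star_def, Complex.conj_ofReal, Complex.ofReal_inv]
    field_simp
    simp
  · rw [Matrix.mul_smul, Matrix.smul_mul, hT X x hx f]

end Weyl

/-! ### Weyl operators of one qudit -/

theorem charP_of_card {F : Type*} [Field F] [Fintype F] {p k : ℕ} (hp : p.Prime)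
    (hF : Fintype.card F = (p ^ k) ^ 2) : CharP F p := by
  obtain ⟨p', hc⟩ := CharP.exists F
  obtain ⟨j, hp', hj⟩ := FiniteField.card F p'
  have h : p' ∣ (p ^ k) ^ 2 := by
    rw [← hF, hj]; exact dvd_pow_self _ j.pos.ne'
  have h' := (Nat.prime_dvd_prime_iff_eq hp' hp).1 (hp'.dvd_of_dvd_pow (hp'.dvd_of_dvd_pow h))
  exact h' ▸ hc

theorem IsConj.of_card {F : Type*} [Field F] [Fintype F] {q : ℕ} (hq : IsPrimePow q)
    (hF : Fintype.card F = q ^ 2) : IsConj F q := by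
  obtain ⟨p, k, hp, hk, rfl⟩ := hq
  have hp' : p.Prime := hp.nat_prime
  have := Fact.mk hp'
  have : CharP F p := charP_of_card hp' hF
  refine ⟨fun x y => add_pow_char_pow .., fun x => ?_, ?_⟩
  · rw [← pow_mul, ← sq, ← hF, FiniteField.pow_card]
  · exact pow_ne_zero _ hp'.ne_zero

theorem two_ne_zero_of_card {F : Type*} [Field F] [Fintype F] {q : ℕ} (hodd : Odd q)
    (hF : Fintype.card F = q ^ 2) : (2 : F) ≠ 0 := by
  intro h
  have h1 : ((q ^ 2 : ℕ) : F) = 0 := by rw [← hF, Nat.cast_card_eq_zero]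
  obtain ⟨j, hj⟩ := hodd
  apply one_ne_zero (α := F)
  rw [hj] at h1; push_cast at h1
  linear_combination h1 - (2 * j ^ 2 + 2 * j : F) * h

section Single

variable {F : Type*} [Field F] {q : ℕ}

/-- Splitting into symmetric and antisymmetric parts gives `F = B ⊕ γB` with `B` the fixed set,
whence `q² = |B|²`. -/
theorem card_fixed [Fintype F] (hF : IsConj F q) (hcard : Fintype.card F = q ^ 2)
    (h2 : (2 : F) ≠ 0) (γ : F) (hγ0 : γ ≠ 0) (hγ : γ ^ q = -γ) :
    Nat.card {x : F // x ^ q = x} = q := by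
  have h2q : (2 : F) ^ q = 2 := by
    have := hF.add_pow 1 1
    rwa [one_pow, one_add_one_eq_two] at this
  let f : {x : F // x ^ q = x} × {x : F // x ^ q = x} → F := fun p => p.1 + γ * p.2
  have hf : Function.Bijective f := by
    constructor
    · rintro ⟨⟨a, ha⟩, b, hb⟩ ⟨⟨a', ha'⟩, b', hb'⟩ h
      simp only [f] at h
      have h' := congrArg (· ^ q) h
      simp only [hF.add_pow, mul_pow, ha, hb, ha', hb', hγ] at h'
      have h1 : a = a' := mul_left_cancel₀ h2 (by linear_combination h + h')
      have h3 : b = b' := mul_left_cancel₀ (mul_ne_zero h2 hγ0) (by linear_combination h - h')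
      subst h1 h3; rfl
    · intro e
      refine ⟨(⟨(e + e ^ q) / 2, ?_⟩, ⟨(e - e ^ q) / (2 * γ), ?_⟩), ?_⟩
      · rw [div_pow, hF.add_pow, hF.pow_pow, h2q, add_comm]
      · rw [div_pow, hF.sub_pow, hF.pow_pow, mul_pow, h2q, hγ]
        field_simp; ring
      · simp only [f]; field_simp; ring
  have := Nat.card_congr (Equiv.ofBijective f hf)
  rw [Nat.card_prod, Nat.card_eq_fintype_card (α := F), hcard, ← sq] at this
  exact Nat.pow_left_injective (n := 2) (by norm_num) this

/-- Composing `ψ` with `x ↦ x - x ^ q` kills the norms `x * x ^ q` and makes conjugation act as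
negation. The trace-zero element `γ` gives nondegeneracy once `ψ (2γ) ≠ 1`. -/
theorem exists_herm_char [Finite F] (hF : IsConj F q) (h2 : (2 : F) ≠ 0) (γ : F) (hγ0 : γ ≠ 0)
    (hγ : γ ^ q = -γ) :
    ∃ ψ χ : AddChar F ℂ, IsHermChar q χ ∧ (∀ x, star (ψ x) = ψ (-x)) ∧
      ∀ x, χ x = ψ (x - x ^ q) := by
  obtain ⟨ψ, hψ⟩ := (AddChar.exists_apply_ne_zero (a := 2 * γ)).2 (mul_ne_zero h2 hγ0)
  have hstar : ∀ x, star (ψ x) = ψ (-x) := fun x => (AddChar.map_neg_eq_conj ψ x).symm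
  refine ⟨ψ, ⟨fun x => ψ (x - x ^ q), ?_, ?_⟩, ⟨?_, ?_, ?_, ?_⟩, hstar, fun x => rfl⟩
  · simp [zero_pow hF.ne_zero]
  · intro x y
    rw [hF.add_pow, ← AddChar.map_add_eq_mul]
    congr 1; ring
  · intro x
    change star (ψ _) = ψ _
    rw [hstar, hF.neg_pow]; congr 1; ring
  · intro x
    change ψ _ = ψ _
    rw [hF.pow_pow, hF.neg_pow]; congr 1; ring
  · intro x
    change ψ _ = _
    rw [mul_pow, hF.pow_pow, mul_comm, sub_self, AddChar.map_zero_eq_one]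
  · intro x hx
    -- This choice makes `x * y ^ q = γ / 2`, so the two values of `χ` are `ψ γ` and `ψ (-γ)`.
    refine ⟨(γ / x / 2) ^ q, fun h => hψ ?_⟩
    change ψ _ = ψ _ at h
    have h2q : (2 : F) ^ q = 2 := by
      have := hF.add_pow 1 1
      rwa [one_pow, one_add_one_eq_two] at this
    have e1 : x * ((γ / x / 2) ^ q) ^ q = γ / 2 := by rw [hF.pow_pow]; field_simp
    have e2 : (γ / x / 2) ^ q * x ^ q = -γ / 2 := by
      rw [← mul_pow, ← hγ, ← h2q, ← div_pow, h2q]; congr 1; field_simp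
    have e3 : (γ / 2) ^ q = -γ / 2 := by rw [div_pow, hγ, h2q]
    have e4 : (-γ / 2) ^ q = γ / 2 := by rw [← e3, hF.pow_pow]
    rw [e1, e2, e3, e4] at h
    have e5 : γ / 2 - -γ / 2 = γ := by field_simp; ring
    have e6 : -γ / 2 - γ / 2 = -γ := by field_simp; ring
    rw [e5, e6] at h
    rw [two_mul, AddChar.map_add_eq_mul]
    nth_rewrite 1 [h]
    rw [← AddChar.map_add_eq_mul, neg_add_cancel, AddChar.map_zero_eq_one]

/-- The Weyl relations for one qudit. -/
structure IsWeylSingle (q : ℕ) (χ : AddChar F ℂ) (w : F → Matrix (Fin q) (Fin q) ℂ) : Prop where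
  zero : w 0 = 1
  mul : ∀ e f, w e * w f = χ (e * f ^ q) • w (e + f)
  conjTranspose : ∀ e, (w e)ᴴ = w (-e)

theorem exists_weyl_single [Fintype F] (hF : IsConj F q) (hcard : Fintype.card F = q ^ 2)
    (h2 : (2 : F) ≠ 0) (γ : F) (hγ0 : γ ≠ 0) (hγ : γ ^ q = -γ) :
    ∃ χ : AddChar F ℂ, IsHermChar q χ ∧ ∃ w : F → Matrix (Fin q) (Fin q) ℂ,
      IsWeylSingle q χ w := by
  classical
  obtain ⟨ψ, χ, hχ, hstar, hψ⟩ := exists_herm_char hF h2 γ hγ0 hγ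
  refine ⟨χ, hχ, ?_⟩
  let B := {x : F // x ^ q = x}
  have hB : Nat.card B = q := card_fixed hF hcard h2 γ hγ0 hγ
  let t : Fin q ≃ B := (finCongr hB.symm).trans (Finite.equivFin B).symm
  -- A shift by `e + e ^ q` together with a phase in the antisymmetric part of `e`. The half-product
  -- in the phase is symmetric ordering: it makes the multiplier exactly `ψ (x - x ^ q)` with `x = e
  -- * f ^ q`, and the adjoint exactly `u (-e)`.
  let u : F → Matrix B B ℂ := fun e => Matrix.of fun x z =>
    if (x : F) = z + (e + e ^ q) then ψ ((e - e ^ q) * z + (e - e ^ q) * (e + e ^ q) / 2) else 0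
  have hu0 : u 0 = 1 := by
    ext x z
    simp only [u, Matrix.of_apply, Matrix.one_apply, zero_pow hF.ne_zero]
    by_cases h : x = z
    · simp [h]
    · have h' : (x : F) ≠ z := fun h' => h (Subtype.ext h')
      simp [h, h']
  have humul : ∀ e f, u e * u f = χ (e * f ^ q) • u (e + f) := by
    intro e f
    ext x z
    have hy : (z + (f + f ^ q) : F) ^ q = z + (f + f ^ q) := by
      rw [hF.add_pow, hF.add_pow, hF.pow_pow, z.2, add_comm (f ^ q)]
    rw [Matrix.mul_apply, Finset.sum_eq_single ⟨z + (f + f ^ q), hy⟩]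
    · simp only [u, Matrix.smul_apply, Matrix.of_apply, if_true]
      have hc : (x : F) = z + (f + f ^ q) + (e + e ^ q) ↔
          (x : F) = z + (e + f + (e + f) ^ q) := by
        rw [hF.add_pow]
        constructor <;> intro h <;> rw [h] <;> ring
      by_cases hx : (x : F) = z + (f + f ^ q) + (e + e ^ q)
      · rw [if_pos hx, if_pos (hc.1 hx), smul_eq_mul, hψ, ← AddChar.map_add_eq_mul,
          ← AddChar.map_add_eq_mul, hF.add_pow, mul_pow, hF.pow_pow]
        congr 1
        field_simp
        ring
      · rw [if_neg hx, if_neg (fun h => hx (hc.2 h))]; simp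
    · intro y _ hy'
      have : (y : F) ≠ z + (f + f ^ q) := fun h => hy' (Subtype.ext h)
      simp only [u, Matrix.of_apply, if_neg this, mul_zero]
    · simp
  have hustar : ∀ e, (u e)ᴴ = u (-e) := by
    intro e
    ext x z
    rw [Matrix.conjTranspose_apply]
    simp only [u, Matrix.of_apply]
    have hc : (z : F) = x + (e + e ^ q) ↔ (x : F) = z + (-e + (-e) ^ q) := by
      rw [hF.neg_pow]
      constructor <;> intro h <;> rw [h] <;> ring
    by_cases hx : (z : F) = x + (e + e ^ q)
    · rw [if_pos hx, if_pos (hc.1 hx), hstar, hF.neg_pow, hx]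
      congr 1
      field_simp
      ring
    · rw [if_neg hx, if_neg (fun h => hx (hc.2 h)), star_zero]
  refine ⟨fun e => (u e).submatrix t t, ?_, ?_, ?_⟩
  · rw [hu0, Matrix.submatrix_one_equiv]
  · intro e f
    rw [Matrix.submatrix_mul_equiv, humul]; rfl
  · intro e
    rw [Matrix.conjTranspose_submatrix, hustar]

end Single

/-! ### Weyl operators of several qudits -/

section Tensor

variable {F : Type*} [Field F] {q : ℕ} {χ : AddChar F ℂ} {w : F → Matrix (Fin q) (Fin q) ℂ}

/-- The tensor product of the operators `w (e i)`. -/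
def weylOp {ι : Type*} [Fintype ι] (w : F → Matrix (Fin q) (Fin q) ℂ) (e : ι → F) :
    Matrix (ι → Fin q) (ι → Fin q) ℂ := fun a b => ∏ i, w (e i) (a i) (b i)

theorem AddChar_sum (χ : AddChar F ℂ) {ι : Type*} (s : Finset ι) (f : ι → F) :
    χ (∑ i ∈ s, f i) = ∏ i ∈ s, χ (f i) := by
  classical
  induction s using Finset.induction_on with
  | empty => simp
  | insert a s ha ih => rw [Finset.sum_insert ha, AddChar.map_add_eq_mul, ih, Finset.prod_insert ha]

theorem IsWeylSingle.isWeyl (hw : IsWeylSingle q χ w) (ι : Type*) [Fintype ι] [DecidableEq ι] :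
    IsWeyl q χ (weylOp (ι := ι) w) := by
  refine ⟨?_, ?_, ?_⟩
  · ext a b
    simp only [weylOp, Pi.zero_apply, hw.zero, Matrix.one_apply, Finset.prod_ite_zero]
    simp [funext_iff]
  · intro e f
    ext a b
    rw [Matrix.mul_apply]
    simp only [weylOp, Matrix.smul_apply, ← Finset.prod_mul_distrib]
    rw [herm, AddChar_sum, smul_eq_mul, ← Finset.prod_mul_distrib]
    have h := Finset.prod_univ_sum (fun _ : ι => (Finset.univ : Finset (Fin q)))
      (fun i x => w (e i) (a i) x * w (f i) x (b i))
    rw [Fintype.piFinset_univ] at h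
    rw [← h]
    refine Finset.prod_congr rfl fun i _ => ?_
    rw [← Matrix.mul_apply, hw.mul]; rfl
  · intro e
    ext a b
    simp only [weylOp, Matrix.conjTranspose_apply, star_prod]
    refine Finset.prod_congr rfl fun i _ => ?_
    rw [← Matrix.conjTranspose_apply, hw.conjTranspose]; rfl

open scoped Kronecker in
/-- The Weyl operators of a pair of registers. -/
def weylPair {κ κ' : Type*} [Fintype κ] [Fintype κ'] (w : F → Matrix (Fin q) (Fin q) ℂ)
    (f : κ ⊕ κ' → F) : Matrix ((κ → Fin q) × (κ' → Fin q)) ((κ → Fin q) × (κ' → Fin q)) ℂ :=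
  weylOp w (f ∘ Sum.inl) ⊗ₖ weylOp w (f ∘ Sum.inr)

theorem IsWeylSingle.isWeyl_pair (hw : IsWeylSingle q χ w) (κ κ' : Type*) [Fintype κ]
    [DecidableEq κ] [Fintype κ'] [DecidableEq κ'] :
    IsWeyl q χ (weylPair (κ := κ) (κ' := κ') w) := by
  have h := hw.isWeyl κ
  have h' := hw.isWeyl κ'
  refine ⟨?_, ?_, ?_⟩
  · rw [weylPair]
    change Matrix.kroneckerMap _ (weylOp w 0) (weylOp w 0) = 1
    rw [h.zero, h'.zero, Matrix.one_kronecker_one]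
  · intro e f
    rw [weylPair, weylPair, ← Matrix.mul_kronecker_mul, h.mul, h'.mul, Matrix.smul_kronecker,
      Matrix.kronecker_smul, smul_smul, ← AddChar.map_add_eq_mul, herm, herm, herm,
      Fintype.sum_sum_type]
    rfl
  · intro e
    rw [weylPair, Matrix.conjTranspose_kronecker, h.conjTranspose, h'.conjTranspose]
    rfl

theorem actsOn_weylOp (hw : IsWeylSingle q χ w) {n : ℕ} (e : Fin n → F) (S : Finset (Fin n))
    (he : ∀ i, i ∉ S → e i = 0) : ActsOn (weylOp w e) S := by
  refine ⟨weylOp w fun i : S => e i, fun a a' => ?_⟩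
  simp only [weylOp]
  rw [← Finset.prod_mul_prod_compl S, ← Finset.prod_coe_sort S]
  have : ∀ i ∈ Sᶜ, w (e i) (a i) (a' i) = if a i = a' i then 1 else 0 := fun i hi => by
    rw [he i (by simpa using hi), hw.zero, Matrix.one_apply]
  rw [Finset.prod_congr rfl this, Finset.prod_ite_zero]
  simp only [Finset.mem_compl]
  split_ifs <;> simp

/-- The Weyl operators on the qudits of `S` span all operators there, and tensoring one with the
identity is the Weyl operator of the vector extended by zero. -/
theorem ActsOn.mem_span [Fintype F] (hF : IsConj F q) (hχ : IsHermChar q χ)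
    (hw : IsWeylSingle q χ w) (hcard : Fintype.card F = q ^ 2) {n : ℕ}
    {E : Matrix (Labels q n) (Labels q n) ℂ} {S : Finset (Fin n)} (hE : ActsOn E S) :
    E ∈ Submodule.span ℂ (weylOp w '' {e : Fin n → F | ∀ i, i ∉ S → e i = 0}) := by
  classical
  obtain ⟨M, hM⟩ := hE
  have : NeZero q := ⟨hF.ne_zero⟩
  have hMs : M ∈ Submodule.span ℂ (Set.range (weylOp (ι := S) w)) := by
    rw [(hw.isWeyl S).span_eq_top hF hχ]
    · trivial
    · simp [hcard, ← pow_mul, mul_comm]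
  let T : Matrix (S → Fin q) (S → Fin q) ℂ →ₗ[ℂ] Matrix (Labels q n) (Labels q n) ℂ :=
    { toFun := fun M => Matrix.of fun a a' => if ∀ i : Fin n, i ∉ S → a i = a' i then
        M (fun i => a i) (fun i => a' i) else 0
      map_add' := fun M N => by ext a a'; simp only [Matrix.add_apply, Matrix.of_apply]; split_ifs <;> simp
      map_smul' := fun c M => by
        ext a a'; simp only [Matrix.smul_apply, Matrix.of_apply, RingHom.id_apply]; split_ifs <;> simp }
  have hET : E = T M := by ext a a'; exact hM a a'
  have := Submodule.mem_map_of_mem (f := T) hMs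
  rw [Submodule.map_span, ← hET] at this
  refine Submodule.span_mono ?_ this
  rintro _ ⟨_, ⟨e, rfl⟩, rfl⟩
  let e' : Fin n → F := fun i => if h : i ∈ S then e ⟨i, h⟩ else 0
  refine ⟨e', fun i hi => by simp [e', hi], ?_⟩
  ext a a'
  change _ = if ∀ i : Fin n, i ∉ S → a i = a' i then weylOp w e (fun i => a i) (fun i => a' i) else 0
  simp only [weylOp]
  rw [← Finset.prod_mul_prod_compl S, ← Finset.prod_coe_sort S]
  have : ∀ i ∈ Sᶜ, w (e' i) (a i) (a' i) = if a i = a' i then 1 else 0 := fun i hi => by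
    have hi' : i ∉ S := by simpa using hi
    rw [show e' i = 0 by simp [e', hi'], hw.zero, Matrix.one_apply]
  rw [Finset.prod_congr rfl this, Finset.prod_ite_zero]
  simp only [Finset.mem_compl]
  have h' : ∀ i : S, e' i = e i := fun i => by simp [e']
  simp only [h']
  split_ifs <;> simp

end Tensor

/-! ### Detectable errors and the partial trace -/

section PartialTrace

variable {X Y : Type*} [Fintype Y]

/-- The partial trace over the second factor. -/
def partialTrace (A : Matrix (X × Y) (X × Y) ℂ) : Matrix X X ℂ :=
  Matrix.of fun x x' => ∑ b, A (x, b) (x', b)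

theorem partialTrace_smul (z : ℂ) (A : Matrix (X × Y) (X × Y) ℂ) :
    partialTrace (z • A) = z • partialTrace A := by
  ext; simp [partialTrace, Finset.mul_sum]

theorem partialTrace_add (A B : Matrix (X × Y) (X × Y) ℂ) :
    partialTrace (A + B) = partialTrace A + partialTrace B := by
  ext; simp [partialTrace, Finset.sum_add_distrib]

theorem partialTrace_one [DecidableEq X] [DecidableEq Y] :
    partialTrace (1 : Matrix (X × Y) (X × Y) ℂ) = (Fintype.card Y : ℂ) • 1 := by
  ext x x'
  by_cases h : x = x' <;> simp [partialTrace, Matrix.one_apply, h]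

open scoped Kronecker in
theorem partialTrace_kronecker (A : Matrix X X ℂ) (B : Matrix Y Y ℂ) :
    partialTrace (A ⊗ₖ B) = B.trace • A := by
  ext x x'
  simp [partialTrace, Matrix.trace, Matrix.kroneckerMap_apply, ← Finset.mul_sum, mul_comm]

open scoped Kronecker in
-- Cyclicity of the partial trace holds for operators acting only on the factor that is traced out.
theorem partialTrace_one_kronecker_mul [Fintype X] [DecidableEq X]
    (N : Matrix (X × Y) (X × Y) ℂ) (U : Matrix Y Y ℂ) :
    partialTrace (((1 : Matrix X X ℂ) ⊗ₖ U) * N) = partialTrace (N * ((1 : Matrix X X ℂ) ⊗ₖ U)) := by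
  ext x x'
  simp only [partialTrace, Matrix.of_apply, Matrix.mul_apply, Fintype.sum_prod_type,
    Matrix.kroneckerMap_apply, Matrix.one_apply, ite_mul, mul_ite, one_mul, zero_mul, mul_zero]
  have h1 : ∀ b, ∑ y, ∑ c, (if x = y then U b c * N (y, c) (x', b) else 0) =
      ∑ c, U b c * N (x, c) (x', b) := fun b => by
    rw [Finset.sum_eq_single x] <;> simp +contextual [eq_comm]
  have h2 : ∀ b, ∑ y, ∑ c, (if y = x' then N (x, b) (y, c) * U c b else 0) =
      ∑ c, N (x, b) (x', c) * U c b := fun b => by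
    rw [Finset.sum_eq_single x'] <;> simp +contextual [eq_comm]
  rw [Finset.sum_congr rfl fun b _ => h1 b, Finset.sum_congr rfl fun b _ => h2 b,
    Finset.sum_comm]
  exact Finset.sum_congr rfl fun _ _ => Finset.sum_congr rfl fun _ _ => mul_comm _ _

end PartialTrace

section Detect

variable {q n k c : ℕ} (V : Matrix (Labels q n) (Labels q k × Labels q c) ℂ)

theorem encode_apply (ψ : Labels q k → ℂ) (a : Labels q n) (b : Labels q c) :
    encode V ψ (a, b) =
      ((Real.sqrt ((q : ℝ) ^ c) : ℝ) : ℂ)⁻¹ * ((Matrix.of fun a x => V a (x, b)) *ᵥ ψ) a := by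
  simp only [encode, ebits, Matrix.mulVec, dotProduct, Matrix.of_apply, Finset.mul_sum]
  refine Finset.sum_congr rfl fun x _ => ?_
  rw [Finset.sum_eq_single b]
  · rw [if_pos rfl]; ring
  · intro b' _ hb; rw [if_neg hb]; ring
  · simp

/-- The component of the encoded state at the receiver's label `b` is `q ^ (-c/2)` times the slice
of `V` at `b` applied to `ψ`. Summing over `b` is the partial trace over the sender's halves of the
pairs. -/
theorem dotProduct_applyError (E : Matrix (Labels q n) (Labels q n) ℂ) (φ ψ : Labels q k → ℂ) :
    star (encode V φ) ⬝ᵥ applyError E (encode V ψ) =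
      ((q : ℂ) ^ c)⁻¹ * (star φ ⬝ᵥ partialTrace (Vᴴ * E * V) *ᵥ ψ) := by
  set t : ℂ := ((Real.sqrt ((q : ℝ) ^ c) : ℝ) : ℂ)⁻¹ with ht
  have htt : star t * t = ((q : ℂ) ^ c)⁻¹ := by
    rw [ht, ← Complex.ofReal_inv, Complex.star_def, Complex.conj_ofReal, ← Complex.ofReal_mul,
      ← mul_inv, Real.mul_self_sqrt (by positivity)]
    push_cast; rfl
  let Vb : Labels q c → Matrix (Labels q n) (Labels q k) ℂ := fun b => Matrix.of fun a x => V a (x, b)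
  have h1 : partialTrace (Vᴴ * E * V) = ∑ b, (Vb b)ᴴ * E * Vb b := by
    ext x x'
    rw [Matrix.sum_apply]; rfl
  have h2 : ∀ a b, applyError E (encode V ψ) (a, b) = t * ((E * Vb b) *ᵥ ψ) a := by
    intro a b
    rw [← Matrix.mulVec_mulVec]
    simp only [applyError, encode_apply]
    rw [Matrix.mulVec, dotProduct, Finset.mul_sum]
    exact Finset.sum_congr rfl fun x _ => by ring
  have h3 : star (encode V φ) ⬝ᵥ applyError E (encode V ψ) =
      ∑ b, (star t * t) * (star (Vb b *ᵥ φ) ⬝ᵥ ((E * Vb b) *ᵥ ψ)) := by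
    rw [dotProduct, Fintype.sum_prod_type, Finset.sum_comm]
    refine Finset.sum_congr rfl fun b _ => ?_
    rw [dotProduct, Finset.mul_sum]
    refine Finset.sum_congr rfl fun a _ => ?_
    rw [h2, Pi.star_apply, Pi.star_apply, encode_apply, star_mul']
    ring
  rw [h3, ← Finset.mul_sum, htt, h1, Matrix.sum_mulVec, dotProduct_sum]
  congr 1
  refine Finset.sum_congr rfl fun b _ => ?_
  rw [Matrix.star_mulVec, ← Matrix.dotProduct_mulVec, Matrix.mulVec_mulVec, Matrix.mul_assoc]

theorem detects_iff (hq : q ≠ 0) (hV : Vᴴ * V = 1) (E : Matrix (Labels q n) (Labels q n) ℂ) :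
    Detects V E ↔ ∃ z : ℂ, partialTrace (Vᴴ * E * V) = z • 1 := by
  have hqc : ((q : ℂ) ^ c) ≠ 0 := pow_ne_zero _ (by exact_mod_cast hq)
  have h1 : ∀ φ ψ : Labels q k → ℂ, star (encode V φ) ⬝ᵥ encode V ψ = star φ ⬝ᵥ ψ := by
    intro φ ψ
    have := dotProduct_applyError V 1 φ ψ
    rw [Matrix.mul_one, hV, partialTrace_one] at this
    have h : applyError (1 : Matrix (Labels q n) (Labels q n) ℂ) (encode V ψ) = encode V ψ := by
      ext p; simp [applyError, Matrix.one_apply]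
    rw [h] at this
    rw [this, Matrix.smul_mulVec, Matrix.one_mulVec, dotProduct_smul, smul_eq_mul, ← mul_assoc]
    simp [hqc]
  simp only [Detects, dotProduct_applyError, h1]
  constructor
  · rintro ⟨μ, h⟩
    refine ⟨μ * (q : ℂ) ^ c, ?_⟩
    ext x y
    have := h (Pi.single x 1) (Pi.single y 1)
    rw [inv_mul_eq_iff_eq_mul₀ hqc] at this
    rw [Pi.star_single, star_one, single_one_dotProduct, Matrix.mulVec_single_one] at this
    rw [Matrix.col_apply] at this
    rw [this, Matrix.smul_apply, single_one_dotProduct, Matrix.one_apply, Pi.single_apply,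
      smul_eq_mul]
    ring
  · rintro ⟨z, h⟩
    refine ⟨((q : ℂ) ^ c)⁻¹ * z, fun φ ψ => ?_⟩
    rw [h, Matrix.smul_mulVec, Matrix.one_mulVec, dotProduct_smul, smul_eq_mul, mul_assoc]

end Detect

/-! ### Entanglement-assisted codes from Hermitian spaces -/

/-- Here `R` is the isotropic part of the stabilizer, the vectors `u (inr j)` are its
entanglement-assisted part, and the vectors `u (inl i)` give the logical operators. The word `e₀`
witnesses that the distance is attained. -/
theorem exists_EAQECC {F : Type*} [Field F] [Fintype F] [DecidableEq F] {q n k c d : ℕ}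
    {χ : AddChar F ℂ} {w : F → Matrix (Fin q) (Fin q) ℂ}
    (hF : IsConj F q) (hχ : IsHermChar q χ) (hw : IsWeylSingle q χ w)
    (hcard : Fintype.card F = q ^ 2) (R : Submodule F (Fin n → F))
    (u : Fin k ⊕ Fin c → Fin n → F)
    (hu : ∀ i j, herm q (u i) (u j) = if i = j then 1 else 0)
    (hR : ∀ x ∈ R, ∀ y ∈ R, herm q x y = 0) (hRu : ∀ x ∈ R, ∀ i, herm q x (u i) = 0)
    (hd : ∀ e, (∀ x ∈ R, herm q e x = 0) → (∀ j, herm q e (u (Sum.inr j)) = 0) → e ≠ 0 →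
      d ≤ hammingNorm e)
    (e₀ : Fin n → F) (he₀ : hammingNorm e₀ = d) (hR₀ : e₀ ∉ R)
    (he₀' : ∃ x ∈ R, ∃ t : Fin k → F, e₀ = x + ∑ i, t i • u (Sum.inl i)) :
    ExistsEAQECC q n k d c := by
  classical
  have : NeZero q := ⟨hF.ne_zero⟩
  let φ : (Fin k ⊕ Fin c → F) →+ (Fin n → F) :=
    { toFun := fun f => ∑ i, f i • u i
      map_zero' := by simp
      map_add' := fun f g => by simp [add_smul, Finset.sum_add_distrib] }
  have hφ_apply : ∀ f, φ f = ∑ i, f i • u i := fun f => rfl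
  have hφ : ∀ f g, herm q (φ f) (φ g) = herm q f g := by
    intro f g
    rw [hφ_apply, hφ_apply, herm_sum_left, herm]
    refine Finset.sum_congr rfl fun i _ => ?_
    rw [herm_smul_left, herm_sum_right hF, Finset.sum_eq_single i]
    · rw [herm_smul_right hF, hu, if_pos rfl, mul_one]
    · intro j _ hj
      rw [herm_smul_right hF, hu, if_neg hj.symm, mul_zero]
    · simp
  have hRφ : ∀ x ∈ R, ∀ f, herm q x (φ f) = 0 := by
    intro x hx f
    rw [hφ_apply, herm_sum_right hF]
    refine Finset.sum_eq_zero fun i _ => ?_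
    rw [herm_smul_right hF, hRu x hx, mul_zero]
  have hW := hw.isWeyl (Fin n)
  have hW' := hw.isWeyl_pair (Fin k) (Fin c)
  obtain ⟨V, hV1, hV2⟩ := hW.exists_isometry hF hχ hW'
    (by simp [hcard, ← pow_mul, ← pow_add, mul_comm]) R.toAddSubgroup φ hφ hR hRφ
  -- Operators supported on the halves of the entangled pairs pass cyclically through the partial
  -- trace, so a phase acquired in commuting with them forces it to vanish.
  have hpt : ∀ f : Fin k ⊕ Fin c → F, (∀ i, f (Sum.inl i) = 0) → ∀ N,
      partialTrace (weylPair w f * N) = partialTrace (N * weylPair w f) := by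
    intro f hf N
    have : f ∘ Sum.inl = 0 := by ext i; exact hf i
    rw [weylPair, this, (hw.isWeyl (Fin k)).zero, partialTrace_one_kronecker_mul]
  have hVx : ∀ x ∈ R, ∀ f, Vᴴ * weylOp w (x + φ f) = weylPair w f * Vᴴ := by
    intro x hx f
    have h2 := congrArg Matrix.conjTranspose (hV2 (-x) (R.neg_mem hx) (-f))
    rwa [Matrix.conjTranspose_mul, Matrix.conjTranspose_mul, hW.conjTranspose,
      hW'.conjTranspose, map_neg, neg_neg, neg_add, neg_neg, neg_neg] at h2
  -- An error that does not commute with the stabilizers has partial trace zero.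
  have key : ∀ e x f, x ∈ R → (∀ i, f (Sum.inl i) = 0) →
      χ (herm q e (x + φ f) + herm q e (x + φ f)) ≠ 1 →
      partialTrace (Vᴴ * weylOp w e * V) = 0 := by
    intro e x f hx hf hne
    set N := Vᴴ * weylOp w e * V with hN
    set ω := χ (herm q e (x + φ f) + herm q e (x + φ f)) with hω
    have h1 : N * weylPair w f = ω • (weylPair w f * N) := by
      rw [hN, Matrix.mul_assoc, ← hV2 x hx f, Matrix.mul_assoc, ← Matrix.mul_assoc (weylOp w e),
        hW.op_mul_comm hF hχ, Matrix.smul_mul, Matrix.mul_smul, ← hω, Matrix.mul_assoc,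
        ← Matrix.mul_assoc Vᴴ, hVx x hx f]
      simp only [Matrix.mul_assoc]
    have h2 : partialTrace N = ω • partialTrace N := by
      calc partialTrace N = partialTrace (N * weylPair w f * weylPair w (-f)) := by
            rw [Matrix.mul_assoc, hW'.op_mul_neg hF hχ, Matrix.mul_one]
        _ = ω • partialTrace (weylPair w f * (N * weylPair w (-f))) := by
            rw [h1, Matrix.smul_mul, partialTrace_smul, Matrix.mul_assoc]
        _ = _ := by
            rw [hpt f hf, Matrix.mul_assoc, hW'.op_neg_mul hχ, Matrix.mul_one]
    by_contra h0
    have h3 : (1 - ω) • partialTrace N = 0 := by rw [sub_smul, one_smul, ← h2, sub_self]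
    rcases smul_eq_zero.1 h3 with h | h
    · exact hne (sub_eq_zero.1 h).symm
    · exact h0 h
  have hχ1 : ∀ a : F, a ≠ 0 → ∃ y, χ (a * y ^ q + a * y ^ q) ≠ 1 := by
    intro a ha
    obtain ⟨y, hy⟩ := hχ.nondeg a ha
    refine ⟨y, fun h => hy ?_⟩
    have : y * a ^ q = (a * y ^ q) ^ q := by rw [mul_pow, hF.pow_pow, mul_comm]
    rw [this, hχ.conj, AddChar.map_neg_eq_inv]
    rw [AddChar.map_add_eq_mul] at h
    exact eq_inv_of_mul_eq_one_left h
  refine ⟨V, hV1, ⟨?_, ?_⟩⟩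
  · obtain ⟨x, hx, t, ht⟩ := he₀'
    refine ⟨Finset.univ.filter fun i => e₀ i ≠ 0, weylOp w e₀, he₀, ?_, ?_⟩
    · exact actsOn_weylOp hw e₀ _ fun i hi => by simpa using hi
    · rw [detects_iff V hF.ne_zero hV1]
      rintro ⟨z, hz⟩
      let f : Fin k ⊕ Fin c → F := Sum.elim t 0
      have hf : e₀ = x + φ f := by
        rw [ht, hφ_apply, Fintype.sum_sum_type]; simp [f]
      -- Modulo `R` the error is the logical operator `W t ⊗ 1`. Being invertible with trace zero
      -- when `t ≠ 0`, `W t` is not a scalar, so the error is undetectable.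
      have ht0 : t ≠ 0 := by
        rintro rfl
        apply hR₀
        rw [ht]; simpa using hx
      have e1 : weylPair w f = Matrix.kroneckerMap (fun a b => a * b) (weylOp w t) 1 := by
        rw [weylPair, ← (hw.isWeyl (Fin c)).zero]; rfl
      rw [Matrix.mul_assoc, hf, hV2 x hx f, ← Matrix.mul_assoc, hV1, Matrix.one_mul, e1,
        partialTrace_kronecker, Matrix.trace_one] at hz
      have hWk := hw.isWeyl (Fin k)
      have h4 := congrArg Matrix.trace hz
      rw [Matrix.trace_smul, Matrix.trace_smul, hWk.trace_eq_zero hF hχ t ht0, smul_zero,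
        Matrix.trace_one, smul_eq_mul, eq_comm, mul_eq_zero] at h4
      have hz0 := h4.resolve_right (by exact_mod_cast Fintype.card_ne_zero)
      rw [hz0, zero_smul] at hz
      have h5 := (smul_eq_zero.1 hz).resolve_left (by exact_mod_cast Fintype.card_ne_zero)
      have h6 := hWk.op_mul_neg hF hχ t
      rw [h5, Matrix.zero_mul] at h6
      exact zero_ne_one h6
  · rintro _ ⟨S, E, rfl, hE, hdet⟩
    by_contra! hlt
    apply hdet
    rw [detects_iff V hF.ne_zero hV1]
    have hspan := hE.mem_span hF hχ hw hcard
    clear hdet hE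
    induction hspan using Submodule.span_induction with
    | mem E hE =>
      obtain ⟨e, he, rfl⟩ := hE
      by_cases he0 : e = 0
      · subst he0
        rw [hW.zero, Matrix.mul_one, hV1, partialTrace_one]
        exact ⟨_, rfl⟩
      · have hwt : hammingNorm e ≤ S.card := by
          refine Finset.card_le_card fun i hi => ?_
          by_contra hiS
          exact (Finset.mem_filter.1 hi).2 (he i hiS)
        refine ⟨0, ?_⟩
        rw [zero_smul]
        -- An error lighter than `d` is not orthogonal to all of `R` and all `u (inr j)`. A multiple
        -- of the offending vector gives a nontrivial commutation phase.
        by_cases h1 : ∀ x ∈ R, herm q e x = 0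
        · have h2 : ¬ ∀ j, herm q e (u (Sum.inr j)) = 0 := fun h2 => by
            have := hd e h1 h2 he0
            omega
          push Not at h2
          obtain ⟨j, hj⟩ := h2
          obtain ⟨y, hy⟩ := hχ1 _ hj
          refine key e 0 (Pi.single (Sum.inr j) y) R.zero_mem (fun i => by simp) ?_
          have : φ (Pi.single (Sum.inr j) y) = y • u (Sum.inr j) := by
            rw [hφ_apply, Finset.sum_eq_single (Sum.inr j)]
            · simp
            · intro i _ hi; simp [hi]
            · simp
          rwa [this, zero_add, herm_smul_right hF, mul_comm]
        · push Not at h1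
          obtain ⟨x, hx, hx0⟩ := h1
          obtain ⟨y, hy⟩ := hχ1 _ hx0
          refine key e (y • x) 0 (R.smul_mem y hx) (fun i => rfl) ?_
          rwa [map_zero, add_zero, herm_smul_right hF, mul_comm]
    | zero => exact ⟨0, by ext; simp [partialTrace]⟩
    | add A B _ _ hA hB =>
      obtain ⟨z, hz⟩ := hA
      obtain ⟨z', hz'⟩ := hB
      exact ⟨z + z', by rw [Matrix.mul_add, Matrix.add_mul, partialTrace_add, hz, hz', add_smul]⟩
    | smul a A _ hA =>
      obtain ⟨z, hz⟩ := hA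
      exact ⟨a * z, by rw [Matrix.mul_smul, Matrix.smul_mul, partialTrace_smul, hz, smul_smul]⟩

/-! ### Orthonormal families -/

section Orthonormal

variable {F : Type*} [Field F] {q : ℕ} {ι : Type*} [Fintype ι]

/-- The norm map of a quadratic extension of finite fields is surjective. -/
theorem exists_norm_eq [Fintype F] (hcard : Fintype.card F = q ^ 2) (a : F)
    (ha0 : a ≠ 0) (ha : a ^ q = a) : ∃ b : F, b * b ^ q = a := by
  classical
  obtain ⟨g, hg⟩ := IsCyclic.exists_generator (α := Fˣ)
  obtain ⟨i, hi⟩ := (Submonoid.mem_powers_iff _ _).1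
    ((mem_powers_iff_mem_zpowers).2 (hg (Units.mk0 a ha0)))
  have hq1 : 1 < q := by
    by_contra! h
    have : 1 < q ^ 2 := hcard ▸ Fintype.one_lt_card
    nlinarith
  have ho : orderOf g = q ^ 2 - 1 := by
    rw [orderOf_eq_card_of_forall_mem_zpowers hg, Nat.card_eq_fintype_card, Fintype.card_units, hcard]
  have h1 : g ^ (i * (q - 1)) = 1 := by
    rw [pow_mul, hi]
    have h : Units.mk0 a ha0 ^ q = Units.mk0 a ha0 := Units.ext (by simpa using ha)
    have h' : Units.mk0 a ha0 ^ (q - 1) * Units.mk0 a ha0 = 1 * Units.mk0 a ha0 := by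
      rw [← pow_succ, Nat.sub_add_cancel hq1.le, h, one_mul]
    exact mul_right_cancel h'
  have h2 : q ^ 2 - 1 = (q + 1) * (q - 1) := by
    have := Nat.sq_sub_sq q 1; simpa using this
  -- An element `g ^ i` fixed by the `q`-th power has order dividing `q - 1`, so `i` is a multiple
  -- of `q + 1`, which makes it a norm.
  have h3 : (q + 1) ∣ i := by
    have := orderOf_dvd_of_pow_eq_one h1
    rw [ho, h2] at this
    exact Nat.dvd_of_mul_dvd_mul_right (by omega) this
  obtain ⟨j, rfl⟩ := h3
  refine ⟨((g ^ j : Fˣ) : F), ?_⟩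
  have h4 := congrArg (Units.val) hi
  rw [Units.val_mk0] at h4
  rw [← h4]
  push_cast
  ring

theorem herm_eq_zero_of_forall_self (hF : IsConj F q) (h2 : (2 : F) ≠ 0)
    (W : Submodule F (ι → F)) (h : ∀ x ∈ W, herm q x x = 0) :
    ∀ x ∈ W, ∀ y ∈ W, herm q x y = 0 := by
  intro x hx y hy
  by_contra h0
  set t := herm q x y with ht
  -- The scaling makes both cross terms equal to 1, so this vector has norm 2.
  have h3 := h (x + (t⁻¹) ^ q • y) (W.add_mem hx (W.smul_mem _ hy))
  rw [herm_add_left, herm_add_right hF, herm_add_right hF, herm_smul_right hF, herm_smul_left,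
    herm_smul_left, herm_smul_right hF, h x hx, h y hy, hF.pow_pow, herm_swap hF x y, ← ht,
    ← mul_pow, inv_mul_cancel₀ h0, one_pow] at h3
  apply h2
  linear_combination h3

/-- Every subspace of a Hermitian space is the sum of its radical and the span of an orthonormal
family. -/
theorem exists_orthonormal_family [Fintype F] (hF : IsConj F q) (hcard : Fintype.card F = q ^ 2)
    (h2 : (2 : F) ≠ 0) (W : Submodule F (ι → F)) :
    ∃ (t : ℕ) (u : Fin t → ι → F), (∀ i, u i ∈ W) ∧
      (∀ i j, herm q (u i) (u j) = if i = j then 1 else 0) ∧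
      ∀ x ∈ W, ∃ a : Fin t → F, ∀ y ∈ W, herm q (x - ∑ i, a i • u i) y = 0 := by
  -- Gram–Schmidt: while some vector has nonzero norm, normalise it by surjectivity of the norm and
  -- pass to its orthogonal complement in `W`. Otherwise polarisation shows that the form vanishes
  -- on `W`.
  induction hW : Module.finrank F W using Nat.strong_induction_on generalizing W with
  | _ N ih =>
  by_cases h0 : ∀ x ∈ W, herm q x x = 0
  · refine ⟨0, Fin.elim0, fun i => i.elim0, fun i => i.elim0, fun x hx => ⟨Fin.elim0, ?_⟩⟩
    intro y hy
    simpa using herm_eq_zero_of_forall_self hF h2 W h0 x hx y hy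
  push Not at h0
  obtain ⟨x0, hx0, hne⟩ := h0
  obtain ⟨b, hb⟩ := exists_norm_eq hcard _ hne (herm_swap hF x0 x0).symm
  have hb0 : b ≠ 0 := by rintro rfl; rw [zero_mul] at hb; exact hne hb.symm
  set v := b⁻¹ • x0 with hv
  have hvW : v ∈ W := W.smul_mem _ hx0
  have hvv : herm q v v = 1 := by
    rw [hv, herm_smul_left, herm_smul_right hF, ← hb, inv_pow]
    have : b ^ q ≠ 0 := pow_ne_zero _ hb0
    field_simp
  let f : (ι → F) →ₗ[F] F :=
    { toFun := fun x => herm q x v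
      map_add' := fun x y => herm_add_left x y v
      map_smul' := fun a x => herm_smul_left a x v }
  let W' := W ⊓ LinearMap.ker f
  have hlt : W' < W := by
    refine lt_of_le_of_ne inf_le_left fun h => ?_
    have : v ∈ W' := h ▸ hvW
    have h1 : herm q v v = 0 := this.2
    rw [hvv] at h1
    exact one_ne_zero h1
  obtain ⟨t, u, huW, huu, hu⟩ := ih _ (hW ▸ Submodule.finrank_lt_finrank_of_lt hlt) W' rfl
  have huv : ∀ i, herm q (u i) v = 0 := fun i => (huW i).2
  refine ⟨t + 1, Fin.cons v u, ?_, ?_, ?_⟩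
  · intro i
    refine Fin.cases hvW (fun i => ?_) i
    exact (huW i).1
  · intro i j
    refine Fin.cases ?_ (fun i => ?_) i <;> refine Fin.cases ?_ (fun j => ?_) j
    · simpa using hvv
    · simpa [(Fin.succ_ne_zero j).symm] using herm_eq_zero_swap hF (huv j)
    · simpa using huv i
    · simpa using huu i j
  · intro x hx
    have hx' : x - herm q x v • v ∈ W' := by
      refine ⟨W.sub_mem hx (W.smul_mem _ hvW), ?_⟩
      change herm q _ v = 0
      rw [herm_sub_left, herm_smul_left, hvv, mul_one, sub_self]
    obtain ⟨a, ha⟩ := hu _ hx'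
    refine ⟨Fin.cons (herm q x v) a, fun y hy => ?_⟩
    rw [Fin.sum_univ_succ]
    simp only [Fin.cons_zero, Fin.cons_succ]
    rw [← sub_sub]
    set z := x - herm q x v • v - ∑ i, a i • u i with hz
    have hzv : herm q z v = 0 := by
      rw [hz, herm_sub_left, herm_sum_left]
      have : herm q (x - herm q x v • v) v = 0 := hx'.2
      rw [this, zero_sub, neg_eq_zero]
      exact Finset.sum_eq_zero fun i _ => by rw [herm_smul_left, huv, mul_zero]
    have hy' : y - herm q y v • v ∈ W' := by
      refine ⟨W.sub_mem hy (W.smul_mem _ hvW), ?_⟩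
      change herm q _ v = 0
      rw [herm_sub_left, herm_smul_left, hvv, mul_one, sub_self]
    have hzy := ha _ hy'
    have : y = (y - herm q y v • v) + herm q y v • v := by abel
    rw [this, herm_add_right hF, hzy, herm_smul_right hF, hzv, mul_zero, add_zero]

/-- The radical of a subspace of a Hermitian space. -/
def hermRadical (q : ℕ) (W : Submodule F (ι → F)) : Submodule F (ι → F) where
  carrier := {x | x ∈ W ∧ ∀ y ∈ W, herm q x y = 0}
  zero_mem' := ⟨W.zero_mem, fun y _ => herm_zero_left y⟩
  add_mem' := fun {a b} ha hb => ⟨W.add_mem ha.1 hb.1, fun y hy => by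
    rw [herm_add_left, ha.2 y hy, hb.2 y hy, add_zero]⟩
  smul_mem' := fun a x hx => ⟨W.smul_mem a hx.1, fun y hy => by
    rw [herm_smul_left, hx.2 y hy, mul_zero]⟩

theorem mem_hermRadical {W : Submodule F (ι → F)} {x : ι → F} :
    x ∈ hermRadical q W ↔ x ∈ W ∧ ∀ y ∈ W, herm q x y = 0 := Iff.rfl

/-- Pairing with the orthonormal family maps `W` onto `F ^ t`, with kernel the radical. -/
theorem card_add_finrank_hermRadical [Fintype F] (W : Submodule F (ι → F)) {t : ℕ}
    (u : Fin t → ι → F) (huW : ∀ i, u i ∈ W)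
    (huu : ∀ i j, herm q (u i) (u j) = if i = j then 1 else 0)
    (hu : ∀ x ∈ W, ∃ a : Fin t → F, ∀ y ∈ W, herm q (x - ∑ i, a i • u i) y = 0) :
    t + Module.finrank F (hermRadical q W) = Module.finrank F W := by
  let f : W →ₗ[F] (Fin t → F) :=
    { toFun := fun x i => herm q (x : ι → F) (u i)
      map_add' := fun x y => by ext i; exact herm_add_left _ _ _
      map_smul' := fun a x => by ext i; exact herm_smul_left _ _ _ }
  have hcomb : ∀ (a : Fin t → F) j, herm q (∑ i, a i • u i) (u j) = a j := by
    intro a j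
    rw [herm_sum_left, Finset.sum_eq_single j]
    · rw [herm_smul_left, huu, if_pos rfl, mul_one]
    · intro i _ hi; rw [herm_smul_left, huu, if_neg hi, mul_zero]
    · simp
  have hsurj : LinearMap.range f = ⊤ := by
    rw [LinearMap.range_eq_top]
    intro a
    refine ⟨⟨∑ i, a i • u i, W.sum_mem fun i _ => W.smul_mem _ (huW i)⟩, ?_⟩
    ext j
    exact hcomb a j
  have hker : (LinearMap.ker f).map W.subtype = hermRadical q W := by
    ext x
    rw [Submodule.mem_map, mem_hermRadical]
    constructor
    · rintro ⟨⟨y, hy⟩, hk, rfl⟩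
      refine ⟨hy, fun z hz => ?_⟩
      obtain ⟨a, ha⟩ := hu y hy
      have h0 : a = 0 := by
        ext j
        have h1 := ha _ (huW j)
        have h2 : herm q y (u j) = 0 := congrFun (LinearMap.mem_ker.1 hk) j
        rw [herm_sub_left, hcomb, h2, zero_sub, neg_eq_zero] at h1
        exact h1
      simpa [h0] using ha z hz
    · rintro ⟨hx, h⟩
      exact ⟨⟨x, hx⟩, by ext j; exact h _ (huW j), rfl⟩
  have h1 := LinearMap.finrank_range_add_finrank_ker f
  rw [hsurj, finrank_top, Module.finrank_fin_fun] at h1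
  rw [← hker, ← h1]
  congr 1
  exact Submodule.finrank_map_subtype_eq _ _

end Orthonormal

/-! ### Entanglement-assisted codes from linear codes -/

section ParityCheck

variable {F : Type*} [Field F] {m n q : ℕ} {H : Matrix (Fin m) (Fin n) F}
  {C : Submodule F (Fin n → F)}

theorem IsParityCheck.exists_right_inverse (hH : IsParityCheck H C) :
    ∃ B : Matrix (Fin n) (Fin m) F, H * B = 1 := by
  rw [← Matrix.mulVec_surjective_iff_exists_right_inverse]
  have h := hH.1.rank_matrix
  rw [Fintype.card_fin, Matrix.rank] at h
  have h' : LinearMap.range H.mulVecLin = ⊤ := Submodule.eq_top_of_finrank_eq (by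
    rw [h, Module.finrank_fin_fun])
  exact LinearMap.range_eq_top.1 h'

theorem IsParityCheck.finrank_add (hH : IsParityCheck H C) : m + Module.finrank F C = n := by
  have h := hH.1.rank_matrix
  have h1 := LinearMap.finrank_range_add_finrank_ker H.mulVecLin
  have h2 : LinearMap.ker H.mulVecLin = C := by
    ext c; rw [hH.2, LinearMap.mem_ker, Matrix.mulVecLin_apply]
  rw [Fintype.card_fin, Matrix.rank] at h
  rw [h, h2, Module.finrank_fin_fun] at h1
  exact h1

theorem exists_isParityCheck (C : Submodule F (Fin n → F)) :
    ∃ (m : ℕ) (H : Matrix (Fin m) (Fin n) F), IsParityCheck H C := by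
  let e := Module.finBasis F ((Fin n → F) ⧸ C)
  let f : (Fin n → F) →ₗ[F] (Fin _ → F) := e.equivFun.toLinearMap ∘ₗ C.mkQ
  have hf : Function.Surjective f := e.equivFun.surjective.comp C.mkQ_surjective
  refine ⟨_, LinearMap.toMatrix' f, ?_, fun c => ?_⟩
  · rw [← Matrix.vecMul_injective_iff]
    intro y z hyz
    simp only at hyz
    refine dotProduct_eq _ _ fun x => ?_
    obtain ⟨x, rfl⟩ := hf x
    rw [← LinearMap.toMatrix'_mulVec, Matrix.dotProduct_mulVec, Matrix.dotProduct_mulVec, hyz]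
  · rw [LinearMap.toMatrix'_mulVec]
    simp [f]

/-- The combinations of the conjugated rows of `H`. -/
def conjRowMap (q : ℕ) (H : Matrix (Fin m) (Fin n) F) : (Fin m → F) →ₗ[F] (Fin n → F) :=
  (conjTransposeQ q H).mulVecLin

theorem conjRowMap_apply (z : Fin m → F) (j : Fin n) :
    conjRowMap q H z j = ∑ i, H i j ^ q * z i := rfl

theorem herm_conjRowMap (hF : IsConj F q) (c : Fin n → F) (z : Fin m → F) :
    herm q c (conjRowMap q H z) = ∑ i, (H *ᵥ c) i * z i ^ q := by
  simp only [herm, conjRowMap_apply, hF.sum_pow, mul_pow, hF.pow_pow, Matrix.mulVec, dotProduct,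
    Finset.mul_sum, Finset.sum_mul]
  rw [Finset.sum_comm]
  exact Finset.sum_congr rfl fun _ _ => Finset.sum_congr rfl fun _ _ => by ring

theorem IsParityCheck.mem_iff_herm (hF : IsConj F q) (hH : IsParityCheck H C) (c : Fin n → F) :
    c ∈ C ↔ ∀ z, herm q c (conjRowMap q H z) = 0 := by
  rw [hH.2]
  constructor
  · intro h z
    rw [herm_conjRowMap hF, h]; simp
  · intro h
    ext i
    have := h (Pi.single i 1)
    rw [herm_conjRowMap hF, Finset.sum_eq_single i] at this
    · simpa using this
    · intro j _ hj; simp [hj, zero_pow hF.ne_zero]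
    · simp

theorem IsParityCheck.conjRowMap_injective (hF : IsConj F q) (hH : IsParityCheck H C) :
    Function.Injective (conjRowMap q H) := by
  obtain ⟨B, hB⟩ := hH.exists_right_inverse
  rw [← LinearMap.ker_eq_bot, LinearMap.ker_eq_bot']
  intro z hz
  refine eq_zero_of_herm_eq_zero hF z fun y => herm_eq_zero_swap hF ?_
  have := herm_conjRowMap (H := H) hF (B *ᵥ y) z
  rw [hz, herm_zero_right hF, Matrix.mulVec_mulVec, hB, Matrix.one_mulVec] at this
  exact this.symm

theorem IsParityCheck.mem_range_conjRowMap (hF : IsConj F q) (hH : IsParityCheck H C)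
    (y : Fin n → F) : y ∈ LinearMap.range (conjRowMap q H) ↔ ∀ c ∈ C, herm q y c = 0 := by
  constructor
  · rintro ⟨z, rfl⟩ c hc
    exact herm_eq_zero_swap hF ((hH.mem_iff_herm hF c).1 hc z)
  · intro h
    obtain ⟨B, hB⟩ := hH.exists_right_inverse
    -- The form with `y` vanishes on `C` and so depends only on `H *ᵥ x`, through the representative
    -- `B *ᵥ (H *ᵥ x)`. The outer `q`-th power cancels the conjugation in the second argument.
    refine ⟨fun i => (∑ j, y j ^ q * B j i) ^ q, ?_⟩
    rw [← sub_eq_zero]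
    refine eq_zero_of_herm_eq_zero hF _ fun x => herm_eq_zero_swap hF ?_
    have hx : x - B *ᵥ (H *ᵥ x) ∈ C := by
      rw [hH.2, Matrix.mulVec_sub, Matrix.mulVec_mulVec, hB, Matrix.one_mulVec, sub_self]
    have h1 := herm_eq_zero_swap hF (h _ hx)
    rw [herm_sub_left, sub_eq_zero] at h1
    rw [sub_eq_add_neg, herm_add_right hF, herm_neg_right hF, h1, herm_conjRowMap hF,
      ← sub_eq_add_neg, sub_eq_zero]
    simp only [hF.pow_pow, herm, Matrix.mulVec, dotProduct, Finset.sum_mul, Finset.mul_sum]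
    rw [Finset.sum_comm]
    exact Finset.sum_congr rfl fun _ _ => Finset.sum_congr rfl fun _ _ =>
      Finset.sum_congr rfl fun _ _ => by ring

/-- The code and its Hermitian dual have the same radical; orthonormal complements of it in each
supply the logical operators and the entangled part of the stabilizer. The spanning hypothesis with
`k ≠ 0` gives a minimum-weight word outside the radical. -/
theorem exists_EAQECC_of_code [Fintype F] [DecidableEq F] (hq : IsPrimePow q) (hodd : Odd q)
    (hcard : Fintype.card F = q ^ 2) (γ : F) (hγ0 : γ ≠ 0) (hγ : γ ^ q = -γ)
    (hH : IsParityCheck H C) {k c d : ℕ} (hrank : (H * conjTransposeQ q H).rank = c)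
    (hk : k + 2 * m = n + c) (hd : ∀ e ∈ C, e ≠ 0 → d ≤ hammingNorm e)
    (hspan : C ≤ Submodule.span F {e | e ∈ C ∧ hammingNorm e = d}) (hk0 : k ≠ 0) :
    ExistsEAQECC q n k d c := by
  have hF := IsConj.of_card hq hcard
  have h2 := two_ne_zero_of_card hodd hcard
  obtain ⟨χ, hχ, w, hw⟩ := exists_weyl_single hF hcard h2 γ hγ0 hγ
  set D := LinearMap.range (conjRowMap q H) with hD
  have hDC : ∀ y, y ∈ D ↔ ∀ x ∈ C, herm q y x = 0 := hH.mem_range_conjRowMap hF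
  have hCD : ∀ x, x ∈ C ↔ ∀ y ∈ D, herm q x y = 0 := by
    intro x
    rw [hH.mem_iff_herm hF, hD]
    simp
  obtain ⟨k', u, huC, huu, hu⟩ := exists_orthonormal_family hF hcard h2 C
  obtain ⟨c', v, hvD, hvv, hv⟩ := exists_orthonormal_family hF hcard h2 D
  have hu' := card_add_finrank_hermRadical C u huC huu hu
  have hv' := card_add_finrank_hermRadical D v hvD hvv hv
  have hRD : hermRadical q D = hermRadical q C := by
    ext x
    rw [mem_hermRadical, mem_hermRadical, ← hCD, ← hDC, and_comm]
  have hfD : Module.finrank F D = m := by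
    rw [hD, LinearMap.finrank_range_of_inj (hH.conjRowMap_injective hF), Module.finrank_fin_fun]
  -- A combination of the conjugated rows lies in `C` exactly when its coefficients are in the
  -- kernel of `HH*`, so the radical has dimension `m - c`.
  have hfR : c + Module.finrank F (hermRadical q C) = m := by
    have h3 : hermRadical q C =
        (LinearMap.ker (H * conjTransposeQ q H).mulVecLin).map (conjRowMap q H) := by
      ext x
      rw [mem_hermRadical, ← hDC, hH.2, Submodule.mem_map]
      constructor
      · rintro ⟨hx, z, rfl⟩
        refine ⟨z, ?_, rfl⟩
        rw [LinearMap.mem_ker, Matrix.mulVecLin_apply, ← Matrix.mulVec_mulVec]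
        exact hx
      · rintro ⟨z, hz, rfl⟩
        rw [LinearMap.mem_ker, Matrix.mulVecLin_apply, ← Matrix.mulVec_mulVec] at hz
        exact ⟨hz, z, rfl⟩
    rw [h3, ← (Submodule.equivMapOfInjective _ (hH.conjRowMap_injective hF) _).finrank_eq, ← hrank,
      Matrix.rank, LinearMap.finrank_range_add_finrank_ker, Module.finrank_fin_fun]
  have hdim := hH.finrank_add
  rw [hRD] at hv'
  obtain rfl : c' = c := by omega
  obtain rfl : k' = k := by omega
  -- If the radical contained all words of weight `d` it would be all of `C`, and `k` would be 0.
  obtain ⟨e₀, ⟨he₀, hwt⟩, hne⟩ : ∃ e ∈ {e | e ∈ C ∧ hammingNorm e = d}, e ∉ hermRadical q C := by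
    by_contra! h
    have h3 : hermRadical q C = C :=
      le_antisymm (fun x hx => hx.1) (hspan.trans (Submodule.span_le.2 h))
    rw [h3] at hu'
    omega
  refine exists_EAQECC hF hχ hw hcard (hermRadical q C) (Sum.elim u v) ?_ ?_ ?_ ?_ e₀ hwt hne ?_
  · rintro (i | i) (j | j)
    · simpa using huu i j
    · simpa using herm_eq_zero_swap hF ((hDC _).1 (hvD j) _ (huC i))
    · simpa using (hDC _).1 (hvD i) _ (huC j)
    · simpa using hvv i j
  · exact fun x hx y hy => hx.2 y hy.1
  · rintro x hx (i | i)
    · exact hx.2 _ (huC i)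
    · rw [← hRD] at hx; exact hx.2 _ (hvD i)
  · intro e he1 he2 he0
    refine hd e ((hCD e).2 fun y hy => ?_) he0
    obtain ⟨a, ha⟩ := hv y hy
    have hr : y - ∑ i, a i • v i ∈ hermRadical q C := by
      rw [← hRD]
      exact ⟨D.sub_mem hy (D.sum_mem fun i _ => D.smul_mem _ (hvD i)), ha⟩
    have h3 := he1 _ hr
    rw [sub_eq_add_neg, herm_add_right hF, herm_neg_right hF, herm_sum_right hF,
      Finset.sum_eq_zero, neg_zero, add_zero] at h3
    · exact h3
    · intro i _
      rw [herm_smul_right hF, show herm q e (v i) = 0 from he2 i, mul_zero]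
  · obtain ⟨a, ha⟩ := hu e₀ he₀
    refine ⟨e₀ - ∑ i, a i • u i, ⟨C.sub_mem he₀ (C.sum_mem fun i _ => C.smul_mem _ (huC i)), ha⟩,
      a, ?_⟩
    simp

end ParityCheck

/-! ### Words and polynomials -/

section WordPoly

variable {F : Type*} [Field F] {n : ℕ}

theorem coeff_wordPoly (c : Fin n → F) (i : Fin n) : (wordPoly c).coeff i = c i := by
  rw [wordPoly, finsetSum_coeff, Finset.sum_eq_single i]
  · simp
  · intro j _ hj
    rw [coeff_C_mul, coeff_X_pow, if_neg (fun h => hj (Fin.ext h).symm), mul_zero]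
  · simp

theorem degree_wordPoly_lt (c : Fin n → F) : (wordPoly c).degree < n := by
  rw [wordPoly]
  refine (degree_sum_le _ _).trans_lt ?_
  rw [Finset.sup_lt_iff (by exact WithBot.bot_lt_coe n)]
  intro i _
  exact (degree_C_mul_X_pow_le _ _).trans_lt (by exact_mod_cast i.2)

theorem wordPoly_coeff (P : F[X]) (hP : P.degree < n) :
    wordPoly (fun i : Fin n => P.coeff i) = P := by
  ext j
  by_cases hj : j < n
  · exact coeff_wordPoly (fun i : Fin n => P.coeff i) ⟨j, hj⟩
  · have h : (n : WithBot ℕ) ≤ j := by exact_mod_cast not_lt.1 hj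
    rw [coeff_eq_zero_of_degree_lt ((degree_wordPoly_lt _).trans_le h),
      coeff_eq_zero_of_degree_lt (hP.trans_le h)]

theorem wordPoly_add (c d : Fin n → F) : wordPoly (c + d) = wordPoly c + wordPoly d := by
  simp [wordPoly, add_mul, Finset.sum_add_distrib]

theorem wordPoly_smul (a : F) (c : Fin n → F) : wordPoly (a • c) = a • wordPoly c := by
  simp [wordPoly, Finset.smul_sum, smul_eq_C_mul, mul_assoc]

/-- Multiplication by `X` followed by replacing the overflow `Xⁿ` by `α`. -/
theorem wordPoly_constaShift (α : F) (c : Fin n → F) (hn : 0 < n) :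
    ∃ a : F, wordPoly (constaShift α c) = X * wordPoly c - C a * (X ^ n - C α) := by
  obtain ⟨k, rfl⟩ : ∃ k, n = k + 1 := ⟨n - 1, by omega⟩
  refine ⟨c (Fin.last k), ?_⟩
  rw [wordPoly, wordPoly, Fin.sum_univ_succ, Fin.sum_univ_castSucc]
  have h0 : constaShift α c 0 = α * c (Fin.last k) := rfl
  have h1 : ∀ i : Fin k, constaShift α c i.succ = c i.castSucc := fun i => rfl
  simp only [h0, h1, Fin.val_zero, pow_zero, mul_one, Fin.val_succ, Fin.val_castSucc, Fin.val_last,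
    mul_add, Finset.mul_sum, C_mul]
  have h2 : ∑ i : Fin k, X * (C (c i.castSucc) * X ^ (i : ℕ)) =
      ∑ i : Fin k, C (c i.castSucc) * X ^ ((i : ℕ) + 1) :=
    Finset.sum_congr rfl fun i _ => by ring
  rw [h2]
  ring

theorem IsGeneratorPoly.mem_iff {α : F} {C' : Submodule F (Fin n → F)} {g : F[X]}
    (h : IsGeneratorPoly α C' g) (c : Fin n → F) : c ∈ C' ↔ g ∣ wordPoly c := by
  rw [h.2.2, Ideal.mem_span_singleton]
  constructor
  · rintro ⟨y, hy⟩
    obtain ⟨p, rfl⟩ := Ideal.Quotient.mk_surjective y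
    rw [← map_mul, Ideal.Quotient.eq, Ideal.mem_span_singleton] at hy
    have := (h.2.1.trans hy).add (dvd_mul_right g p)
    rwa [sub_add_cancel] at this
  · exact fun hd => map_dvd _ hd

/-- The code of the words whose polynomial is divisible by `g`. -/
def codeOf (n : ℕ) (g : F[X]) : Submodule F (Fin n → F) where
  carrier := {c | g ∣ wordPoly c}
  zero_mem' := by simp [wordPoly]
  add_mem' := fun {a b} ha hb => by
    change g ∣ _
    rw [wordPoly_add]; exact dvd_add ha hb
  smul_mem' := fun a c hc => by
    change g ∣ _
    rw [wordPoly_smul]; exact hc.trans (Dvd.intro_left (C a) (smul_eq_C_mul a).symm)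

theorem mem_codeOf {g : F[X]} {c : Fin n → F} : c ∈ codeOf n g ↔ g ∣ wordPoly c := Iff.rfl

theorem isGeneratorPoly_codeOf {g : F[X]} {α : F} (hg : g.Monic) (hd : g ∣ X ^ n - C α) :
    IsGeneratorPoly α (codeOf n g) g := by
  refine ⟨hg, hd, fun c => ⟨fun hc => ?_, ?_⟩⟩
  · rw [Ideal.mem_span_singleton]
    exact map_dvd _ hc
  · rw [Ideal.mem_span_singleton]
    rintro ⟨y, hy⟩
    obtain ⟨p, rfl⟩ := Ideal.Quotient.mk_surjective y
    rw [← map_mul, Ideal.Quotient.eq, Ideal.mem_span_singleton] at hy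
    have := (hd.trans hy).add (dvd_mul_right g p)
    rwa [sub_add_cancel] at this

theorem isConstacyclic_codeOf {g : F[X]} {α : F} (hd : g ∣ X ^ n - C α) :
    IsConstacyclic α (codeOf n g) := by
  intro c hc
  rcases Nat.eq_zero_or_pos n with rfl | hn
  · rwa [Subsingleton.elim (constaShift α c) c]
  · obtain ⟨a, ha⟩ := wordPoly_constaShift α c hn
    rw [mem_codeOf, ha]
    exact dvd_sub (hc.mul_left _) (hd.mul_left _)

/-- Words map onto `F[X] / (g)`, whose dimension is the degree of `g`, with kernel the code. -/
theorem finrank_codeOf {g : F[X]} (hg : g.Monic) (hn : g.natDegree ≤ n) :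
    Module.finrank F (codeOf n g) + g.natDegree = n := by
  let f : (Fin n → F) →ₗ[F] AdjoinRoot g :=
    { toFun := fun c => AdjoinRoot.mk g (wordPoly c)
      map_add' := fun c d => by rw [wordPoly_add, map_add]
      map_smul' := fun a c => by rw [wordPoly_smul, AdjoinRoot.smul_mk]; rfl }
  have hker : LinearMap.ker f = codeOf n g := by
    ext c
    rw [LinearMap.mem_ker, mem_codeOf]
    exact AdjoinRoot.mk_eq_zero
  have hsurj : LinearMap.range f = ⊤ := by
    rw [LinearMap.range_eq_top]
    intro y
    obtain ⟨p, rfl⟩ := AdjoinRoot.mk_surjective y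
    refine ⟨fun i => (p %ₘ g).coeff i, ?_⟩
    change AdjoinRoot.mk g (wordPoly _) = _
    rw [wordPoly_coeff]
    · rw [AdjoinRoot.mk_eq_mk, ← neg_sub, dvd_neg, ← dvd_neg, neg_sub]
      exact ⟨-(p /ₘ g), by linear_combination modByMonic_add_div p g⟩
    · refine (degree_modByMonic_lt p hg).trans_le ?_
      rw [degree_eq_natDegree hg.ne_zero]
      exact_mod_cast hn
  have h := LinearMap.finrank_range_add_finrank_ker f
  rw [hker, hsurj, finrank_top, (AdjoinRoot.powerBasis' hg).finrank, AdjoinRoot.powerBasis'_dim,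
    Module.finrank_fin_fun] at h
  omega

/-- The words of the polynomials `X ^ i * g` span the code. -/
theorem codeOf_le_span {g : F[X]} (hg : g.Monic) :
    codeOf n g ≤ Submodule.span F {e | ∃ i, i + g.natDegree < n ∧
      e = fun t : Fin n => (X ^ i * g).coeff t} := by
  intro c hc
  obtain ⟨h, hh⟩ := mem_codeOf.1 hc
  have hcoeff : c = ∑ i ∈ h.support, h.coeff i • fun t : Fin n => (X ^ i * g).coeff t := by
    ext t
    rw [← coeff_wordPoly c t, hh, Finset.sum_apply]
    conv_lhs => rw [h.as_sum_support_C_mul_X_pow, Finset.mul_sum, finsetSum_coeff]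
    refine Finset.sum_congr rfl fun i _ => ?_
    rw [Pi.smul_apply, smul_eq_mul, ← coeff_C_mul]
    congr 1; ring
  rw [hcoeff]
  refine Submodule.sum_mem _ fun i hi => Submodule.smul_mem _ _ (Submodule.subset_span ⟨i, ?_, rfl⟩)
  have h0 : h ≠ 0 := by rintro rfl; simp at hi
  have hdeg := degree_wordPoly_lt c
  rw [hh, degree_mul, degree_eq_natDegree hg.ne_zero, degree_eq_natDegree h0] at hdeg
  have := le_natDegree_of_mem_supp i hi
  have : g.natDegree + h.natDegree < n := by exact_mod_cast hdeg
  omega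

theorem coeff_mem_codeOf {g : F[X]} (hg : g.Monic) {i : ℕ} (hi : i + g.natDegree < n) :
    (fun t : Fin n => (X ^ i * g).coeff t) ∈ codeOf n g := by
  rw [mem_codeOf, wordPoly_coeff]
  · exact dvd_mul_left _ _
  · rw [degree_mul, degree_X_pow, degree_eq_natDegree hg.ne_zero]
    exact_mod_cast hi

theorem coeff_ne_zero {g : F[X]} (hg : g.Monic) {i : ℕ} (hi : i + g.natDegree < n) :
    (fun t : Fin n => (X ^ i * g).coeff t) ≠ 0 := by
  intro h
  have := congrFun h ⟨i + g.natDegree, hi⟩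
  simp only [Pi.zero_apply] at this
  rw [add_comm, coeff_X_pow_mul, coeff_natDegree, hg.leadingCoeff] at this
  exact one_ne_zero this

theorem hammingNorm_coeff_le [DecidableEq F] (g : F[X]) (i : ℕ) :
    hammingNorm (fun t : Fin n => (X ^ i * g).coeff t) ≤ g.natDegree + 1 := by
  rw [hammingNorm, ← Finset.card_map Fin.valEmbedding]
  refine (Finset.card_le_card (t := Finset.Icc i (i + g.natDegree)) ?_).trans (by simp; omega)
  intro t ht
  obtain ⟨t', ht', rfl⟩ := Finset.mem_map.1 ht
  have h := (Finset.mem_filter.1 ht').2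
  rw [coeff_X_pow_mul'] at h
  simp only [ne_eq, ite_eq_right_iff, Classical.not_imp] at h
  have := le_natDegree_of_ne_zero h.2
  rw [Finset.mem_Icc, Fin.valEmbedding_apply]
  omega

/-- The BCH bound. -/
theorem bch_bound [DecidableEq F] {K : Type*} [Field K] [Algebra F K] {η β : K}
    (hη : IsPrimitiveRoot η n) (hβ : β ≠ 0) (ℓ : ℕ) (c : Fin n → F) (hc0 : c ≠ 0)
    (hc : ∀ j < ℓ, aeval (β * η ^ j) (wordPoly c) = 0) : ℓ + 1 ≤ hammingNorm c := by
  classical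
  by_contra! hlt
  obtain ⟨t₀, ht₀⟩ := Function.ne_iff.1 hc0
  set T : Finset (Fin n) := Finset.univ.filter fun i => c i ≠ 0 with hT
  have hTc : T.card ≤ ℓ := by
    have : hammingNorm c = T.card := rfl
    omega
  have ht₀T : t₀ ∈ T := by simpa [hT] using ht₀
  -- Linear combinations of the `ℓ` vanishing conditions allow any polynomial of degree below `ℓ` in
  -- `η ^ t` as a weight.
  have key : ∀ P : K[X], P.natDegree < ℓ →
      ∑ t : Fin n, algebraMap F K (c t) * β ^ (t : ℕ) * P.eval (η ^ (t : ℕ)) = 0 := by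
    intro P hP
    simp only [eval_eq_sum_range' hP, Finset.mul_sum]
    rw [Finset.sum_comm]
    refine Finset.sum_eq_zero fun j hj => ?_
    have h1 := hc j (Finset.mem_range.1 hj)
    rw [wordPoly, map_sum] at h1
    have h2 : ∑ t : Fin n, algebraMap F K (c t) * β ^ (t : ℕ) * (P.coeff j * (η ^ (t : ℕ)) ^ j) =
        P.coeff j * ∑ t : Fin n, aeval (β * η ^ j) (C (c t) * X ^ (t : ℕ)) := by
      rw [Finset.mul_sum]
      refine Finset.sum_congr rfl fun t _ => ?_
      simp only [map_mul, aeval_C, map_pow, aeval_X, mul_pow]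
      ring
    rw [h2, h1, mul_zero]
  -- Vanishing at every point of the support except `t₀`, this weight isolates `c t₀`; its degree is
  -- below `ℓ` because the support has at most `ℓ` points.
  set P : K[X] := ∏ t ∈ T.erase t₀, (X - C (η ^ (t : ℕ))) with hP
  have hdeg : P.natDegree < ℓ := by
    rw [hP, natDegree_prod_of_monic _ _ fun t _ => monic_X_sub_C _]
    simp only [natDegree_X_sub_C, Finset.sum_const, smul_eq_mul, mul_one]
    have := Finset.card_erase_lt_of_mem ht₀T
    omega
  have h1 := key P hdeg
  rw [Finset.sum_eq_single t₀] at h1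
  · have hη0 : β ^ (t₀ : ℕ) ≠ 0 := pow_ne_zero _ hβ
    have hc1 : algebraMap F K (c t₀) ≠ 0 := by
      rw [Ne, FaithfulSMul.algebraMap_eq_zero_iff]; exact ht₀
    refine mul_ne_zero (mul_ne_zero hc1 hη0) ?_ h1
    rw [hP, eval_prod, Finset.prod_ne_zero_iff]
    intro t ht
    rw [eval_sub, eval_X, eval_C, sub_ne_zero]
    intro h
    exact (Finset.mem_erase.1 ht).1 (Fin.ext (hη.pow_inj t₀.2 t.2 h)).symm
  · intro t _ ht
    by_cases htT : t ∈ T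
    · rw [hP, eval_prod, Finset.prod_eq_zero (Finset.mem_erase.2 ⟨ht, htT⟩), mul_zero]
      rw [eval_sub, eval_X, eval_C, sub_self]
    · have : c t = 0 := by simpa [hT] using htT
      rw [this]; simp
  · simp

end WordPoly

/-! ### The roots of the generator polynomial -/

section Roots

variable {F K : Type*} [Field F] [Field K] [Algebra F K] {q n r s : ℕ} {δ : K}

theorem exists_frobenius [Fintype F] (hq : IsPrimePow q) (hcard : Fintype.card F = q ^ 2)
    (K : Type*) [Field K] [Algebra F K] : ∃ φ : K →+* K, ∀ x, φ x = x ^ q := by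
  obtain ⟨p, k, hp, hk, rfl⟩ := hq
  have hp' : p.Prime := hp.nat_prime
  have := Fact.mk hp'
  have : CharP F p := charP_of_card hp' hcard
  have : CharP K p := charP_of_injective_algebraMap (algebraMap F K).injective p
  exact ⟨iterateFrobenius K p k, fun x => iterateFrobenius_def ..⟩

/-- The polynomial `X ^ |F| - X` has at most `|F|` roots in `K`, and the image of `F` already
supplies that many. -/
theorem mem_range_algebraMap [Fintype F] (x : K) (hx : x ^ Fintype.card F = x) :
    x ∈ Set.range (algebraMap F K) := by
  classical
  have h1 := Fintype.one_lt_card (α := F)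
  have hne := FiniteField.X_pow_card_sub_X_ne_zero K h1
  have hsub : Finset.univ.image (algebraMap F K) ⊆
      (X ^ Fintype.card F - X : K[X]).roots.toFinset := by
    intro y hy
    obtain ⟨a, -, rfl⟩ := Finset.mem_image.1 hy
    rw [Multiset.mem_toFinset, mem_roots hne]
    simp [IsRoot, ← map_pow, FiniteField.pow_card]
  have hle : (X ^ Fintype.card F - X : K[X]).roots.toFinset.card ≤
      (Finset.univ.image (algebraMap F K)).card := by
    rw [Finset.card_image_of_injective _ (algebraMap F K).injective, Finset.card_univ]
    refine (Multiset.toFinset_card_le _).trans ((card_roots' _).trans ?_)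
    rw [FiniteField.X_pow_card_sub_X_natDegree_eq K h1]
  have heq := Finset.eq_of_subset_of_card_le hsub hle
  have hmem : x ∈ (X ^ Fintype.card F - X : K[X]).roots.toFinset := by
    rw [Multiset.mem_toFinset, mem_roots hne]
    simp [IsRoot, hx]
  rw [← heq] at hmem
  obtain ⟨a, -, ha⟩ := Finset.mem_image.1 hmem
  exact ⟨a, ha⟩

theorem pow_intCast_val {N : ℕ} (hN : N ≠ 0) (hδ : IsPrimitiveRoot δ N) (z : ℤ) :
    δ ^ (z : ZMod N).val = δ ^ z := by
  have : NeZero N := ⟨hN⟩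
  have hδ0 : δ ≠ 0 := hδ.ne_zero hN
  rw [← zpow_natCast, ZMod.val_intCast, Int.emod_def, zpow_sub₀ hδ0, zpow_mul, zpow_natCast,
    hδ.pow_eq_one, one_zpow, div_one]

theorem pow_expo_val (hN : r * n ≠ 0) (hδ : IsPrimitiveRoot δ (r * n)) (j : ℤ) :
    δ ^ (expo r n s j).val = δ ^ s * (δ ^ r) ^ j := by
  rw [expo_eq_intCast, pow_intCast_val hN hδ, zpow_add₀ (hδ.ne_zero hN), zpow_mul, zpow_natCast,
    zpow_natCast]

theorem pow_val_injective {N : ℕ} (hN : N ≠ 0) (hδ : IsPrimitiveRoot δ N) (x y : ZMod N)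
    (h : δ ^ x.val = δ ^ y.val) : x = y := by
  have : NeZero N := ⟨hN⟩
  exact ZMod.val_injective N (hδ.pow_inj x.val_lt y.val_lt h)

/-- The product of `X - δ ^ (s + r j)` over `|j| ≤ b`. -/
def rootProd (r s b : ℕ) (δ : K) : K[X] :=
  ∏ j ∈ Finset.Icc (-(b : ℤ)) b, (X - C (δ ^ s * (δ ^ r) ^ j))

theorem monic_rootProd (r s b : ℕ) (δ : K) : (rootProd r s b δ).Monic :=
  monic_prod_of_monic _ _ fun _ _ => monic_X_sub_C _

theorem natDegree_rootProd (r s b : ℕ) (δ : K) : (rootProd r s b δ).natDegree = 2 * b + 1 := by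
  rw [rootProd, natDegree_prod_of_monic _ _ fun _ _ => monic_X_sub_C _]
  simp only [natDegree_X_sub_C, Finset.sum_const, smul_eq_mul, mul_one, Int.card_Icc]
  omega

theorem eval_rootProd (r s b : ℕ) (δ x : K) : (rootProd r s b δ).eval x = 0 ↔
    ∃ j ∈ Finset.Icc (-(b : ℤ)) b, x = δ ^ s * (δ ^ r) ^ j := by
  rw [rootProd, eval_prod, Finset.prod_eq_zero_iff]
  simp [sub_eq_zero]

theorem root_injOn (hN : r * n ≠ 0) (hδ : IsPrimitiveRoot δ (r * n)) {b : ℕ} (hb : 2 * b < n)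
    {i j : ℤ} (hi : i ∈ Finset.Icc (-(b : ℤ)) b) (hj : j ∈ Finset.Icc (-(b : ℤ)) b)
    (h : δ ^ s * (δ ^ r) ^ i = δ ^ s * (δ ^ r) ^ j) : i = j := by
  rw [← pow_expo_val hN hδ, ← pow_expo_val hN hδ] at h
  have h1 := pow_val_injective hN hδ _ _ h
  have hr : 0 < r := Nat.pos_of_ne_zero (left_ne_zero_of_mul hN)
  rw [expo_eq_expo_iff hr] at h1
  rw [Finset.mem_Icc] at hi hj
  have := Int.eq_zero_of_abs_lt_dvd h1 (by rw [abs_lt]; omega)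
  omega

theorem root_pow (hδ : IsPrimitiveRoot δ (r * n)) {α : F} (hδα : δ ^ n = algebraMap F K α)
    (hexp : ∀ j : ℤ, expo r n s j ∈ rootExponents r n) (hN : r * n ≠ 0) (j : ℤ) :
    (δ ^ s * (δ ^ r) ^ j) ^ n = algebraMap F K α := by
  rw [← pow_expo_val hN hδ]
  obtain ⟨t, -, ht⟩ := hexp j
  have h1 : (1 : ZMod (r * n)) + r * t = ((1 + r * t : ℤ) : ZMod (r * n)) := by push_cast; ring
  rw [ht, h1, pow_intCast_val hN hδ]
  have h2 : (δ ^ (1 + r * t : ℤ)) = δ ^ (1 + r * t) := by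
    rw [← zpow_natCast]; push_cast; rfl
  rw [h2, ← hδα, ← pow_mul, show (1 + r * t) * n = n + (r * n) * t by ring, pow_add,
    pow_mul δ (r * n), hδ.pow_eq_one, one_pow, mul_one]

theorem rootProd_dvd (hδ : IsPrimitiveRoot δ (r * n)) {α : F} (hδα : δ ^ n = algebraMap F K α)
    (hexp : ∀ j : ℤ, expo r n s j ∈ rootExponents r n) (hN : r * n ≠ 0) {b : ℕ} (hb : 2 * b < n) :
    rootProd r s b δ ∣ (X ^ n - C α : F[X]).map (algebraMap F K) := by
  refine Finset.prod_dvd_of_coprime ?_ ?_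
  · intro i hi j hj hij
    refine isCoprime_X_sub_C_of_isUnit_sub (Ne.isUnit ?_)
    exact sub_ne_zero.2 fun h => hij (root_injOn hN hδ hb hi hj h)
  · intro j _
    rw [dvd_iff_isRoot]
    simp [IsRoot, root_pow hδ hδα hexp hN]

theorem rootSet_of_map_eq {g : F[X]} (hδ : IsPrimitiveRoot δ (r * n))
    (hexp : ∀ j : ℤ, expo r n s j ∈ rootExponents r n) (hN : r * n ≠ 0) {b : ℕ}
    (hg : g.map (algebraMap F K) = rootProd r s b δ) :
    rootSet r n δ g = expo r n s '' Set.Icc (-(b : ℤ)) b := by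
  have h : ∀ i : ZMod (r * n), aeval (δ ^ i.val) g = 0 ↔
      ∃ j ∈ Finset.Icc (-(b : ℤ)) b, δ ^ i.val = δ ^ s * (δ ^ r) ^ j := fun i => by
    rw [← eval_map_algebraMap, hg, eval_rootProd]
  ext i
  constructor
  · rintro ⟨-, h1⟩
    obtain ⟨j, hj, hij⟩ := (h i).1 h1
    rw [← pow_expo_val hN hδ] at hij
    exact ⟨j, by simpa using hj, (pow_val_injective hN hδ _ _ hij).symm⟩
  · rintro ⟨j, hj, rfl⟩
    exact ⟨hexp j, (h _).2 ⟨j, by simpa using hj, pow_expo_val hN hδ j⟩⟩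

/-- `X ^ n - α` splits over `K` into distinct factors `X - δ ^ (1 + rt)`, so a monic divisor is
determined by its root set. This makes the code with defining set `Z` unique. -/
theorem map_eq_rootProd {g : F[X]} {α : F} (hg : g.Monic) (hd : g ∣ X ^ n - C α)
    (hδ : IsPrimitiveRoot δ (r * n)) (hα : α ≠ 0) (hδα : δ ^ n = algebraMap F K α)
    (hN : r * n ≠ 0) (hnK : (n : K) ≠ 0)
    {b : ℕ} (hb : 2 * b < n) (hZ : rootSet r n δ g = expo r n s '' Set.Icc (-(b : ℤ)) b) :
    g.map (algebraMap F K) = rootProd r s b δ := by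
  classical
  have hn : n ≠ 0 := right_ne_zero_of_mul hN
  have hη : IsPrimitiveRoot (δ ^ r) n := hδ.pow (Nat.pos_of_ne_zero hN) rfl
  have hα' : algebraMap F K α ≠ 0 := by rwa [Ne, FaithfulSMul.algebraMap_eq_zero_iff]
  have hP : (X ^ n - C α : F[X]).map (algebraMap F K) = X ^ n - C (algebraMap F K α) := by simp
  have hP0 : (X ^ n - C (algebraMap F K α) : K[X]) ≠ 0 := X_pow_sub_C_ne_zero (Nat.pos_of_ne_zero hn) _
  have hsplit : (X ^ n - C (algebraMap F K α) : K[X]).Splits :=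
    X_pow_sub_C_splits_of_isPrimitiveRoot hη hδα
  have hd' : g.map (algebraMap F K) ∣ X ^ n - C (algebraMap F K α) := by
    rw [← hP, map_dvd_map']; exact hd
  have hgs := hsplit.of_dvd hP0 hd'
  have hnd : (g.map (algebraMap F K)).roots.Nodup :=
    Multiset.nodup_of_le (roots.le_of_dvd hP0 hd') (nodup_roots (separable_X_pow_sub_C _ hnK hα'))
  have hset : (g.map (algebraMap F K)).roots.toFinset =
      (Finset.Icc (-(b : ℤ)) b).image fun j => δ ^ s * (δ ^ r) ^ j := by
    ext x
    rw [Multiset.mem_toFinset, mem_roots (hg.map _).ne_zero, Finset.mem_image]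
    constructor
    · intro hx
      have hx' : x ^ n = algebraMap F K α := by
        have := hx.dvd hd'
        simpa [IsRoot, sub_eq_zero] using this
      have h1 : (x / δ) ^ n = 1 := by rw [div_pow, hx', hδα, div_self hα']
      have : NeZero n := ⟨hn⟩
      obtain ⟨t, ht, hxt⟩ := hη.eq_pow_of_pow_eq_one h1
      have hδ0 : δ ≠ 0 := hδ.ne_zero hN
      have h2 : x = δ ^ ((1 + r * t : ℤ) : ZMod (r * n)).val := by
        rw [pow_intCast_val hN hδ, zpow_add₀ hδ0, zpow_mul, zpow_natCast, zpow_natCast, hxt,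
          zpow_one, mul_div_cancel₀ _ hδ0]
      have h3 : ((1 + r * t : ℤ) : ZMod (r * n)) ∈ rootSet r n δ g := by
        refine ⟨⟨t, ht, by push_cast; ring⟩, ?_⟩
        rw [← eval_map_algebraMap, ← h2]; exact hx
      rw [hZ] at h3
      obtain ⟨j, hj, h4⟩ := h3
      exact ⟨j, by simpa using hj, by rw [h2, ← h4, pow_expo_val hN hδ]⟩
    · rintro ⟨j, hj, rfl⟩
      have h3 : expo r n s j ∈ rootSet r n δ g := by
        rw [hZ]; exact ⟨j, by simpa using hj, rfl⟩
      have h4 := h3.2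
      rwa [pow_expo_val hN hδ, ← eval_map_algebraMap] at h4
  rw [hgs.eq_prod_roots_of_monic (hg.map _), rootProd]
  have h5 : ((g.map (algebraMap F K)).roots.map fun x => X - C x).prod =
      ∏ x ∈ (g.map (algebraMap F K)).roots.toFinset, (X - C x) := by
    rw [Finset.prod, Multiset.toFinset_val, hnd.dedup]
  rw [h5, hset, Finset.prod_image fun i hi j hj => root_injOn hN hδ hb hi hj]

/-- The map `x ↦ x ^ (q²)` exchanges the roots with indices `j` and `-j`, so it fixes the
coefficients, which therefore lie in the field of `q²` elements. -/
theorem exists_map_eq_rootProd [Fintype F] (hq : IsPrimePow q) (hcard : Fintype.card F = q ^ 2)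
    (hδ : IsPrimitiveRoot δ (r * n)) (hN : r * n ≠ 0)
    (hsq : ∀ j : ℤ, expo r n s j * (q : ZMod (r * n)) ^ 2 = expo r n s (-j)) (b : ℕ) :
    ∃ g : F[X], g.map (algebraMap F K) = rootProd r s b δ := by
  obtain ⟨φ, hφ⟩ := exists_frobenius (F := F) hq hcard K
  have hroot : ∀ j : ℤ, φ (φ (δ ^ s * (δ ^ r) ^ j)) = δ ^ s * (δ ^ r) ^ (-j) := by
    intro j
    rw [hφ, hφ, ← pow_expo_val hN hδ, ← pow_expo_val hN hδ, ← hsq, ← pow_mul, ← pow_mul,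
      ← sq]
    have h1 : expo r n s j * (q : ZMod (r * n)) ^ 2 =
        ((((expo r n s j).val : ℤ) * (q : ℤ) ^ 2 : ℤ) : ZMod (r * n)) := by
      have : NeZero (r * n) := ⟨hN⟩
      push_cast; rw [ZMod.natCast_zmod_val]
    rw [h1, pow_intCast_val hN hδ, ← zpow_natCast]
    push_cast; rfl
  have hfix : (rootProd r s b δ).map (φ.comp φ) = rootProd r s b δ := by
    rw [rootProd, Polynomial.map_prod]
    refine Finset.prod_nbij' (fun j => -j) (fun j => -j) ?_ ?_ ?_ ?_ ?_
    · intro j hj; rw [Finset.mem_Icc] at *; omega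
    · intro j hj; rw [Finset.mem_Icc] at *; omega
    · intro j _; simp
    · intro j _; simp
    · intro j _
      rw [Polynomial.map_sub, map_X, map_C, RingHom.comp_apply, hroot]
  have hl : rootProd r s b δ ∈ lifts (algebraMap F K) := by
    rw [lifts_iff_coeff_lifts]
    intro i
    apply mem_range_algebraMap
    conv_rhs => rw [← hfix]
    rw [coeff_map, RingHom.comp_apply, hφ, hφ, ← pow_mul, ← sq, hcard]
  exact (mem_lifts _).1 hl

end Roots

/-! ### The rank of the Gram matrix -/

section Rank

/-- The rank normal form has entries 0 and 1 and is preserved by `f`, as is invertibility of the two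
transforming matrices. -/
theorem rank_map {F K : Type*} [Field F] [Field K] (f : F →+* K) {m : Type*} [Fintype m]
    [DecidableEq m] (M : Matrix m m F) : (M.map f).rank = M.rank := by
  classical
  obtain ⟨V, U, e, hV, hU, h⟩ := M.exists_rank_normal_form
  have hd : ∀ (L : Type _) [Field L], (Matrix.fromBlocks (1 : Matrix (Fin M.rank) (Fin M.rank) L) 0 0
      (0 : Matrix (Fin (Fintype.card m - M.rank)) (Fin (Fintype.card m - M.rank)) L)).rank = M.rank := by
    intro L _
    have h1 : (Matrix.fromBlocks (1 : Matrix (Fin M.rank) (Fin M.rank) L) 0 0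
      (0 : Matrix (Fin (Fintype.card m - M.rank)) (Fin (Fintype.card m - M.rank)) L)) =
        Matrix.diagonal (Sum.elim 1 0) := by
      rw [← Matrix.fromBlocks_diagonal]
      congr 1
      exact Matrix.diagonal_zero.symm
    have h2 : (Finset.univ.filter fun i => (Sum.elim 1 0 : Fin M.rank ⊕
        Fin (Fintype.card m - M.rank) → L) i ≠ 0) = Finset.univ.map Function.Embedding.inl := by
      ext (i | i) <;> simp
    rw [h1, Matrix.rank_diagonal, Fintype.card_subtype, h2]
    simp
  have h' := congrArg (fun N => (Matrix.map N f)) h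
  simp only [Matrix.map_mul] at h'
  have hmap : ((Matrix.fromBlocks (1 : Matrix (Fin M.rank) (Fin M.rank) F) 0 0
      (0 : Matrix (Fin (Fintype.card m - M.rank)) (Fin (Fintype.card m - M.rank)) F)).submatrix e e).map f =
      (Matrix.fromBlocks (1 : Matrix (Fin M.rank) (Fin M.rank) K) 0 0
      (0 : Matrix (Fin (Fintype.card m - M.rank)) (Fin (Fintype.card m - M.rank)) K)).submatrix e e := by
    rw [← Matrix.submatrix_map, Matrix.fromBlocks_map]
    simp
  rw [hmap] at h'
  have hV' : IsUnit (V.map f).det := by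
    rw [← RingHom.mapMatrix_apply, ← RingHom.map_det]
    exact ((Matrix.isUnit_iff_isUnit_det _).1 hV).map f
  have hU' : IsUnit (U.map f).det := by
    rw [← RingHom.mapMatrix_apply, ← RingHom.map_det]
    exact ((Matrix.isUnit_iff_isUnit_det _).1 hU).map f
  have h2 := congrArg Matrix.rank h'
  rwa [Matrix.rank_mul_eq_left_of_isUnit_det _ _ hU', Matrix.rank_mul_eq_right_of_isUnit_det _ _ hV',
    Matrix.rank_submatrix, hd] at h2

/-- The rank of a multiple of a partial permutation matrix. -/
theorem rank_partialPerm {K : Type*} [Field K] {m t : ℕ} (σ τ : Fin t → Fin m)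
    (hσ : Function.Injective σ) (hτ : Function.Injective τ) (ν : K) (hν : ν ≠ 0)
    (N : Matrix (Fin m) (Fin m) K) (hN : ∀ i, N (σ i) (τ i) = ν)
    (hN0 : ∀ i j, (∀ k, ¬ (i = σ k ∧ j = τ k)) → N i j = 0) : N.rank = t := by
  have hsub : N.submatrix σ τ = ν • (1 : Matrix (Fin t) (Fin t) K) := by
    ext i j
    rw [Matrix.submatrix_apply, Matrix.smul_apply, Matrix.one_apply]
    split_ifs with h
    · subst h; simp [hN]
    · rw [hN0, smul_zero]
      rintro k ⟨h1, h2⟩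
      exact h ((hσ h1).trans (hτ h2).symm)
  -- Factoring through `K ^ t` bounds the rank above; the submatrix `ν • 1` bounds it below.
  have hfac : N = (1 : Matrix (Fin m) (Fin m) K).submatrix id σ *
      (ν • (1 : Matrix (Fin m) (Fin m) K).submatrix τ id) := by
    ext i j
    rw [Matrix.mul_apply]
    simp only [Matrix.submatrix_apply, id, Matrix.smul_apply, Matrix.one_apply, smul_eq_mul,
      mul_ite, mul_one, mul_zero, ite_mul, zero_mul, one_mul]
    by_cases h : ∃ k, i = σ k ∧ j = τ k
    · obtain ⟨k, rfl, rfl⟩ := h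
      rw [Finset.sum_eq_single k]
      · simp [hN]
      · intro k' _ hk'
        rw [if_neg]
        intro h; exact hk' (hτ h)
      · simp
    · push Not at h
      rw [hN0 i j fun k hk => h k hk.1 hk.2, eq_comm]
      refine Finset.sum_eq_zero fun k _ => ?_
      split_ifs with h1 h2
      · exact absurd h1.symm (h k (by assumption))
      all_goals rfl
  apply le_antisymm
  · rw [hfac]
    exact (Matrix.rank_mul_le_left _ _).trans (Matrix.rank_le_width _)
  · have h1 : (N.submatrix σ τ).rank = t := by
      rw [hsub, Matrix.rank_of_det_ne_zero, Fintype.card_fin]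
      rw [Matrix.det_smul, Matrix.det_one, mul_one]
      exact pow_ne_zero _ hν
    have h2 := Matrix.rank_submatrix_le N σ τ
    omega

theorem geom_sum_zpow {K : Type*} [Field K] {n : ℕ} {η : K}
    (hη : IsPrimitiveRoot η n) (e : ℤ) :
    ∑ t : Fin n, (η ^ e) ^ (t : ℕ) = if (n : ℤ) ∣ e then (n : K) else 0 := by
  rw [Fin.sum_univ_eq_sum_range fun t => (η ^ e) ^ t]
  split_ifs with h
  · rw [(hη.zpow_eq_one_iff_dvd e).2 h]; simp
  · have h1 : η ^ e ≠ 1 := fun h1 => h ((hη.zpow_eq_one_iff_dvd e).1 h1)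
    have h2 : (η ^ e) ^ n = 1 := by
      rw [← zpow_natCast, ← zpow_mul, mul_comm, zpow_mul, zpow_natCast, hη.pow_eq_one, one_zpow]
    have h3 := geom_sum_mul (η ^ e) n
    rw [h2, sub_self] at h3
    exact (mul_eq_zero.1 h3).resolve_right (sub_ne_zero.2 h1)

/-- The Gram matrix of a parity check matrix has the same rank as the Gram matrix of the matrix of
powers of the roots. -/
theorem rank_gram {F K : Type*} [Field F] [Field K] [Algebra F K] {q n m : ℕ} (φ : K →+* K)
    (hφ : ∀ x, φ x = x ^ q) {C : Submodule F (Fin n → F)} {H : Matrix (Fin m) (Fin n) F}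
    (hH : IsParityCheck H C) (ρ : Fin m → K) (hρ : Function.Injective ρ) (hmn : m ≤ n)
    (hC : ∀ c ∈ C, ∀ i, ∑ t : Fin n, ρ i ^ (t : ℕ) * algebraMap F K (c t) = 0) :
    (H * conjTransposeQ q H).rank =
      (Matrix.of fun i j => ∑ t : Fin n, (ρ i * ρ j ^ q) ^ (t : ℕ) : Matrix (Fin m) (Fin m) K).rank := by
  set f := algebraMap F K with hf
  let V : Matrix (Fin m) (Fin n) K := Matrix.of fun i t => ρ i ^ (t : ℕ)
  obtain ⟨B, hB⟩ := hH.exists_right_inverse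
  let A : Matrix (Fin m) (Fin m) K := V * B.map f
  -- The columns of `1 - B * H` are words of `C`, and the rows of `V` annihilate `C`.
  have hVA : V = A * H.map f := by
    have h1 : V * ((1 - B * H).map f) = 0 := by
      ext i j
      rw [Matrix.mul_apply, Matrix.zero_apply]
      have h2 : (1 - B * H).col j ∈ C := by
        rw [hH.2]
        have h3 : H * (1 - B * H) = 0 := by
          rw [Matrix.mul_sub, ← Matrix.mul_assoc, hB, Matrix.one_mul, Matrix.mul_one, sub_self]
        ext i
        exact congrFun (congrFun h3 i) j
      exact hC _ h2 i
    rw [Matrix.map_sub _ (map_sub f), Matrix.map_one _ (map_zero f) (map_one f), Matrix.map_mul,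
      Matrix.mul_sub, Matrix.mul_one, sub_eq_zero, ← Matrix.mul_assoc] at h1
    exact h1
  have hA : IsUnit A.det := by
    rw [isUnit_iff_ne_zero]
    intro h0
    obtain ⟨y, hy0, hy⟩ := Matrix.exists_vecMul_eq_zero_iff.2 h0
    have h1 : y ᵥ* V = 0 := by rw [hVA, ← Matrix.vecMul_vecMul, hy, Matrix.zero_vecMul]
    -- The first `m` columns of `V` form a Vandermonde matrix with distinct nodes, so `A` is
    -- invertible.
    refine hy0 (Matrix.eq_zero_of_forall_pow_sum_mul_pow_eq_zero hρ fun t => ?_)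
    exact congrFun h1 (Fin.castLE hmn t)
  have hgram : (Matrix.of fun i j => ∑ t : Fin n, (ρ i * ρ j ^ q) ^ (t : ℕ) :
      Matrix (Fin m) (Fin m) K) = A * (H * conjTransposeQ q H).map f * (A.map φ)ᵀ := by
    have h1 : (Matrix.of fun i j => ∑ t : Fin n, (ρ i * ρ j ^ q) ^ (t : ℕ) :
        Matrix (Fin m) (Fin m) K) = V * (V.map φ)ᵀ := by
      ext i j
      rw [Matrix.of_apply, Matrix.mul_apply]
      refine Finset.sum_congr rfl fun t _ => ?_
      rw [Matrix.transpose_apply, Matrix.map_apply]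
      change _ = ρ i ^ (t : ℕ) * φ (ρ j ^ (t : ℕ))
      rw [map_pow, hφ, mul_pow]
    have h2 : (conjTransposeQ q H).map f = ((H.map f).map φ)ᵀ := by
      ext i j
      simp [conjTransposeQ, hφ]
    rw [h1, Matrix.map_mul, h2]
    conv_lhs => rw [hVA]
    rw [Matrix.map_mul, Matrix.transpose_mul]
    simp only [Matrix.mul_assoc]
  have hA' : IsUnit ((A.map φ)ᵀ).det := by
    rw [Matrix.det_transpose, ← RingHom.mapMatrix_apply, ← RingHom.map_det]
    exact hA.map φ
  rw [hgram, Matrix.rank_mul_eq_left_of_isUnit_det _ _ hA',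
    Matrix.rank_mul_eq_right_of_isUnit_det _ _ hA, rank_map]

end Rank

/-! ### The codes with the given defining set -/

section Codes

variable {F K : Type*} [Field F] [Field K] [Algebra F K] {q n r s m l b : ℕ} {δ : K} {g : F[X]}

theorem monic_of_map_eq (hg : g.map (algebraMap F K) = rootProd r s b δ) : g.Monic := by
  rw [← monic_map_iff (f := algebraMap F K), hg]
  exact monic_rootProd r s b δ

theorem natDegree_of_map_eq (hg : g.map (algebraMap F K) = rootProd r s b δ) :
    g.natDegree = 2 * b + 1 := by
  rw [← natDegree_map (algebraMap F K), hg, natDegree_rootProd]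

theorem aeval_eq_zero_of_mem (hg : g.map (algebraMap F K) = rootProd r s b δ) {c : Fin n → F}
    (hc : c ∈ codeOf n g) {j : ℤ} (hj : j ∈ Finset.Icc (-(b : ℤ)) b) :
    aeval (δ ^ s * (δ ^ r) ^ j) (wordPoly c) = 0 := by
  rw [← eval_map_algebraMap]
  have h1 := (map_dvd_map' (algebraMap F K)).2 (mem_codeOf.1 hc)
  rw [hg] at h1
  exact IsRoot.dvd ((eval_rootProd r s b δ _).2 ⟨j, hj, rfl⟩) h1

theorem le_hammingNorm_of_mem [DecidableEq F] (hδ : IsPrimitiveRoot δ (r * n)) (hN : r * n ≠ 0)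
    (hg : g.map (algebraMap F K) = rootProd r s b δ) (c : Fin n → F) (hc : c ∈ codeOf n g)
    (hc0 : c ≠ 0) : 2 * b + 2 ≤ hammingNorm c := by
  have hδ0 : δ ≠ 0 := hδ.ne_zero hN
  refine bch_bound (hδ.pow (Nat.pos_of_ne_zero hN) rfl : IsPrimitiveRoot (δ ^ r) n)
    (β := δ ^ s * (δ ^ r) ^ (-(b : ℤ)))
    (mul_ne_zero (pow_ne_zero _ hδ0) (zpow_ne_zero _ (pow_ne_zero _ hδ0))) (2 * b + 1) c hc0 ?_
  intro j hj
  rw [mul_assoc, ← zpow_natCast (δ ^ r) j, ← zpow_add₀ (pow_ne_zero _ hδ0)]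
  exact aeval_eq_zero_of_mem hg hc (by rw [Finset.mem_Icc]; omega)

/-- The BCH lower bound meets the upper bound `deg g + 1` on the number of nonzero coefficients. -/
theorem hammingNorm_coeff [DecidableEq F] (hδ : IsPrimitiveRoot δ (r * n)) (hN : r * n ≠ 0)
    (hg : g.map (algebraMap F K) = rootProd r s b δ) {i : ℕ} (hi : i + g.natDegree < n) :
    hammingNorm (fun t : Fin n => (X ^ i * g).coeff t) = 2 * b + 2 := by
  have hgm := monic_of_map_eq hg
  refine le_antisymm ?_ (le_hammingNorm_of_mem hδ hN hg _ (coeff_mem_codeOf hgm hi)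
    (coeff_ne_zero hgm hi))
  have := hammingNorm_coeff_le (n := n) g i
  rwa [natDegree_of_map_eq hg] at this

theorem hasMinDist_codeOf [DecidableEq F] (hδ : IsPrimitiveRoot δ (r * n)) (hN : r * n ≠ 0)
    (hb : 2 * b + 1 < n) (hg : g.map (algebraMap F K) = rootProd r s b δ) :
    HasMinDist (codeOf n g) (2 * b + 2) := by
  have hgm := monic_of_map_eq hg
  have h0 : 0 + g.natDegree < n := by rw [natDegree_of_map_eq hg]; omega
  refine ⟨⟨_, coeff_mem_codeOf hgm h0, coeff_ne_zero hgm h0, hammingNorm_coeff hδ hN hg h0⟩, ?_⟩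
  rintro _ ⟨c, hc, hc0, rfl⟩
  exact le_hammingNorm_of_mem hδ hN hg c hc hc0

theorem rank_parityCheck [Fintype F] (hpp : IsPrimePow q) (hcard : Fintype.card F = q ^ 2)
    (hq : q = 10 * m + 3) (hn : n = 10 * m ^ 2 + 6 * m + 1) (hr : r = q + 1) (hs : s = 5 * n)
    (hl : 1 ≤ l) (hl' : l ≤ m) (hδ : IsPrimitiveRoot δ (r * n)) (hN : r * n ≠ 0)
    (hnK : (n : K) ≠ 0) (hb : b = 3 * m + l) (hbn : 2 * b + 1 < n)
    (hg : g.map (algebraMap F K) = rootProd r s b δ) {m' : ℕ} {H : Matrix (Fin m') (Fin n) F}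
    (hH : IsParityCheck H (codeOf n g)) : (H * conjTransposeQ q H).rank = 5 := by
  have hδ0 : δ ≠ 0 := hδ.ne_zero hN
  have hη : IsPrimitiveRoot (δ ^ r) n := hδ.pow (Nat.pos_of_ne_zero hN) rfl
  have hη0 : δ ^ r ≠ 0 := pow_ne_zero _ hδ0
  have hdeg := natDegree_of_map_eq hg
  have hfin := finrank_codeOf (n := n) (monic_of_map_eq hg) (by omega)
  have hfin' := hH.finrank_add
  obtain rfl : m' = 2 * b + 1 := by omega
  obtain ⟨φ, hφ⟩ := exists_frobenius (F := F) hpp hcard K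
  let ρ : Fin (2 * b + 1) → K := fun i => δ ^ s * (δ ^ r) ^ ((i : ℤ) - b)
  have hmem : ∀ i : Fin (2 * b + 1), ((i : ℤ) - b) ∈ Finset.Icc (-(b : ℤ)) b := by
    intro i; have := i.2; rw [Finset.mem_Icc]; omega
  have hρ : Function.Injective ρ := by
    intro i j hij
    have := root_injOn hN hδ (by omega) (hmem i) (hmem j) hij
    exact Fin.ext (by omega)
  rw [rank_gram φ hφ hH ρ hρ hbn.le]
  swap
  · intro c hc i
    have h1 := aeval_eq_zero_of_mem hg hc (hmem i)
    rw [wordPoly, map_sum] at h1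
    rw [← h1]
    refine Finset.sum_congr rfl fun t _ => ?_
    rw [map_mul, aeval_C, map_pow, aeval_X, mul_comm]
  have hent : ∀ i j : Fin (2 * b + 1), ∑ t : Fin n, (ρ i * ρ j ^ q) ^ (t : ℕ) =
      if (n : ℤ) ∣ q * ((j : ℤ) - b) - (-((i : ℤ) - b)) then (n : K) else 0 := by
    intro i j
    have h1 : ρ i * ρ j ^ q = (δ ^ r) ^ (q * ((j : ℤ) - b) - (-((i : ℤ) - b))) := by
      -- The exponent is `sr = 5rn`, so only powers of `δ ^ r` survive in `ρᵢ ρⱼ ^ q`.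
      have h2 : δ ^ s * (δ ^ s) ^ q = 1 := by
        rw [← pow_succ', ← pow_mul, ← hr, hs, show 5 * n * r = (r * n) * 5 by ring, pow_mul,
          hδ.pow_eq_one, one_pow]
      have h3 : ((δ ^ r) ^ ((j : ℤ) - b)) ^ q = (δ ^ r) ^ (q * ((j : ℤ) - b)) := by
        rw [mul_comm (q : ℤ), zpow_mul, zpow_natCast]
      simp only [ρ]
      rw [mul_pow, h3, mul_mul_mul_comm, h2, one_mul, ← zpow_add₀ hη0]
      congr 1; ring
    rw [h1, geom_sum_zpow hη]
  have hdvd : ∀ i j : Fin (2 * b + 1), _ ↔ _ := fun i j =>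
    dvd_mul_sub_iff hq hn hl hl' ((j : ℤ) - b) (-((i : ℤ) - b))
      (by have := j.2; rw [abs_le]; omega) (by have := i.2; rw [abs_le]; omega)
  -- Positions of the five solutions of `qj ≡ -i` modulo `n`, shifted by `b` to become row and
  -- column numbers: `σ` lists the rows `i`, `τ` the columns `j`.
  let σ : Fin 5 → Fin (2 * b + 1) := ![⟨b, by omega⟩, ⟨b + (3 * m + 1), by omega⟩,
    ⟨b - (3 * m + 1), by omega⟩, ⟨b - m, by omega⟩, ⟨b + m, by omega⟩]
  let τ : Fin 5 → Fin (2 * b + 1) := ![⟨b, by omega⟩, ⟨b + m, by omega⟩, ⟨b - m, by omega⟩,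
    ⟨b + (3 * m + 1), by omega⟩, ⟨b - (3 * m + 1), by omega⟩]
  refine rank_partialPerm σ τ ?_ ?_ (n : K) hnK _ ?_ ?_
  · intro x y hxy
    fin_cases x <;> fin_cases y <;> simp [σ] at hxy ⊢ <;> omega
  · intro x y hxy
    fin_cases x <;> fin_cases y <;> simp [τ] at hxy ⊢ <;> omega
  · intro i
    rw [Matrix.of_apply, hent, if_pos]
    rw [hdvd]
    fin_cases i <;> simp [σ, τ] <;> omega
  · intro i j hij
    rw [Matrix.of_apply, hent, if_neg]
    rw [hdvd]
    have h0 := hij 0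
    have h1 := hij 1
    have h2 := hij 2
    have h3 := hij 3
    have h4 := hij 4
    simp [σ, τ, Fin.ext_iff] at h0 h1 h2 h3 h4
    omega

end Codes

end EAQ

end

/-! ### The main theorem -/

theorem mainTheorem3 {F K : Type*} [Field F] [Fintype F] [DecidableEq F] [Field K] [Algebra F K]
    (q n r s l : ℕ) (hq : IsPrimePow q) (hq3 : q ≡ 3 [MOD 10])
    (hn : n = (q ^ 2 + 1) / 10) (hr : r = q + 1) (hs : s = (q ^ 2 + 1) / 2)
    (hl : 1 ≤ l) (hl' : l ≤ (q - 3) / 10)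
    (hF : Fintype.card F = q ^ 2)
    (α : F) (hα : IsPrimitiveRoot α r)
    (δ : K) (hδ : IsPrimitiveRoot δ (r * n)) (hδα : δ ^ n = algebraMap F K α)
    (coset : ℕ → Set (ZMod (r * n)))
    (hcoset : ∀ j : ℕ, coset j =
      EAQ.cyclotomicCoset q (r * n) ((s : ZMod (r * n)) - (r : ZMod (r * n)) * (j : ZMod (r * n))))
    (Z : Set (ZMod (r * n))) (hZ : Z = ⋃ j ∈ Finset.Icc 0 (3 * (q - 3) / 10 + l), coset j) :
    Z ∩ EAQ.negMul q (r * n) Z = coset 0 ∪ coset ((3 * q + 1) / 10) ∪ coset ((q - 3) / 10) ∧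
    (∃ C : Submodule F (Fin n → F), EAQ.IsConstacyclicWithDefiningSet r n δ α C Z) ∧
    ∃ k d : ℕ,
      (k : ℚ) = (n : ℚ) - 6 / 5 * ((q : ℚ) - 3) - 4 * (l : ℚ) + 3 ∧
      (d : ℚ) = 3 / 5 * ((q : ℚ) - 3) + 2 * (l : ℚ) + 2 ∧
      (∀ C : Submodule F (Fin n → F), EAQ.IsConstacyclicWithDefiningSet r n δ α C Z →
        EAQ.HasMinDist C d ∧
        (k : ℤ) = 2 * (Module.finrank F C : ℤ) - (n : ℤ) + 5 ∧
        ∀ (m : ℕ) (H : Matrix (Fin m) (Fin n) F), EAQ.IsParityCheck H C →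
          (H * EAQ.conjTransposeQ q H).rank = 5) ∧
      EAQ.ExistsEAQECC q n k d 5 ∧
      (n : ℤ) + 5 - (k : ℤ) = 2 * ((d : ℤ) - 1) ∧
      (q ≠ 13 → (d : ℚ) ≤ ((n : ℚ) + 2) / 2) := by
  classical
  obtain ⟨m, hm⟩ : ∃ m, q = 10 * m + 3 := by
    have h : q % 10 = 3 % 10 := hq3
    exact ⟨q / 10, by omega⟩
  have hlm : l ≤ m := by omega
  have hm1 : 1 ≤ m := hl.trans hlm
  have hsq : q ^ 2 + 1 = 10 * (10 * m ^ 2 + 6 * m + 1) := by rw [hm]; ring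
  have hn' : n = 10 * m ^ 2 + 6 * m + 1 := by rw [hn, hsq]; omega
  have hs' : s = 5 * n := by rw [hs, hsq, hn']; omega
  have hN : r * n ≠ 0 := by
    rw [hr, hn']; positivity
  have hb1 : 3 * (q - 3) / 10 = 3 * m := by omega
  have hb2 : (3 * q + 1) / 10 = 3 * m + 1 := by omega
  have hb3 : (q - 3) / 10 = m := by omega
  have hmm : m ≤ m ^ 2 := Nat.le_self_pow two_ne_zero m
  set b := 3 * m + l with hb
  have hbn : 2 * b + 1 < n := by omega
  have hcoset' : ∀ j : ℕ, coset j = EAQ.cyclotomicCoset q (r * n) (EAQ.expo r n s (-(j : ℤ))) := by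
    intro j
    rw [hcoset, EAQ.expo]
    congr 1; push_cast; ring
  have hZ' : Z = EAQ.expo r n s '' Set.Icc (-(b : ℤ)) b := by
    rw [hZ, hb1, ← EAQ.iUnion_cyclotomicCoset hm hn' hr hs']
    simp only [hcoset', hb]
  have hexp : ∀ j : ℤ, EAQ.expo r n s j ∈ EAQ.rootExponents r n :=
    EAQ.expo_mem_rootExponents hm hn' hr hs'
  have hq0 : (q : F) = 0 := by
    have h : ((q ^ 2 : ℕ) : F) = 0 := by rw [← hF, Nat.cast_card_eq_zero]
    push_cast at h
    exact pow_eq_zero_iff two_ne_zero |>.1 h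
  have hnK : (n : K) ≠ 0 := by
    intro h
    have h1 : (q : K) = 0 := by
      rw [← map_natCast (algebraMap F K), hq0, map_zero]
    -- In `K`, where `q = 0`, this reads `1 = 10n`.
    have h2 : ((q ^ 2 + 1 : ℕ) : K) = ((10 * n : ℕ) : K) := by rw [hsq, hn']
    push_cast at h2
    rw [h, h1] at h2
    simp at h2
  have hα0 : α ≠ 0 := hα.ne_zero (left_ne_zero_of_mul hN)
  obtain ⟨g, hg⟩ := EAQ.exists_map_eq_rootProd hq hF hδ hN
    (fun j => EAQ.expo_mul_sq hm hn' hr hs' j) b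
  have hgm := EAQ.monic_of_map_eq hg
  have hgd : g.natDegree = 2 * b + 1 := EAQ.natDegree_of_map_eq hg
  have hdvd : g ∣ X ^ n - C α := by
    rw [← map_dvd_map' (algebraMap F K), hg]
    exact EAQ.rootProd_dvd hδ hδα hexp hN (by omega)
  have huniq : ∀ C : Submodule F (Fin n → F),
      EAQ.IsConstacyclicWithDefiningSet r n δ α C Z → C = EAQ.codeOf n g := by
    rintro C ⟨-, g', hg', hZg⟩
    have h1 := EAQ.map_eq_rootProd hg'.1 hg'.2.1 hδ hα0 hδα hN hnK
      (by omega : 2 * b < n) (hZg.trans hZ')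
    have h2 : g' = g := map_injective _ (algebraMap F K).injective (h1.trans hg.symm)
    ext c
    rw [hg'.mem_iff, EAQ.mem_codeOf, h2]
  have hdist : EAQ.HasMinDist (EAQ.codeOf n g) (2 * b + 2) :=
    EAQ.hasMinDist_codeOf hδ hN hbn hg
  have hfin : Module.finrank F (EAQ.codeOf n g) + (2 * b + 1) = n := by
    rw [← hgd]; exact EAQ.finrank_codeOf hgm (by omega)
  have hrank : ∀ (m' : ℕ) (H : Matrix (Fin m') (Fin n) F),
      EAQ.IsParityCheck H (EAQ.codeOf n g) → (H * EAQ.conjTransposeQ q H).rank = 5 :=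
    fun m' H hH => EAQ.rank_parityCheck hq hF hm hn' hr hs' hl hlm hδ hN hnK hb hbn hg hH
  -- The code has dimension `K = n - (2b + 1)`, so `2K - n + 5 = n + 3 - 4b`.
  obtain ⟨k, hk⟩ : ∃ k, k + 4 * b = n + 3 := ⟨n + 3 - 4 * b, by omega⟩
  have hk0 : k ≠ 0 := by omega
  have hqQ : (q : ℚ) = 10 * m + 3 := by rw [hm]; push_cast; ring
  have hbQ : (b : ℚ) = 3 * m + l := by rw [hb]; push_cast; ring
  refine ⟨?_, ⟨EAQ.codeOf n g, EAQ.isConstacyclic_codeOf hdvd, g,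
    EAQ.isGeneratorPoly_codeOf hgm hdvd, ?_⟩, k, 2 * b + 2, ?_, ?_, ?_, ?_, ?_, ?_⟩
  · rw [hZ', hcoset', hcoset', hcoset', hb2, hb3]
    exact EAQ.image_inter_negMul hm hn' hr hs' hl hlm
  · rw [hZ']
    exact EAQ.rootSet_of_map_eq hδ hexp hN hg
  · have h : (k : ℚ) + 4 * b = n + 3 := by exact_mod_cast hk
    rw [hqQ]; rw [hbQ] at h; linarith
  · push_cast
    rw [hqQ, hbQ]; ring
  · intro C hC
    obtain rfl := huniq C hC
    exact ⟨hdist, by omega, hrank⟩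
  · obtain ⟨m', H, hH⟩ := EAQ.exists_isParityCheck (EAQ.codeOf n g)
    have hm' := hH.finrank_add
    have hα2 : α * α ≠ 1 := by
      intro h
      have h1 := (hα.pow_eq_one_iff_dvd 2).1 (by rw [sq, h])
      have := Nat.le_of_dvd two_pos h1
      omega
    have hαq : α ^ q = α⁻¹ :=
      eq_inv_of_mul_eq_one_left (by rw [← pow_succ, ← hr, hα.pow_eq_one])
    -- Conjugation inverts `α`, since `α` has order `q + 1`; hence `α - α⁻¹` is antisymmetric, and
    -- it is nonzero because that order exceeds 2.
    refine EAQ.exists_EAQECC_of_code hq ⟨5 * m + 1, by omega⟩ hF (α - α⁻¹) ?_ ?_ hH (hrank m' H hH)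
      (by omega) (fun e he he0 => EAQ.le_hammingNorm_of_mem hδ hN hg e he he0) ?_ hk0
    · intro h
      apply hα2
      rw [sub_eq_zero] at h
      nth_rewrite 2 [h]
      exact mul_inv_cancel₀ hα0
    · rw [(EAQ.IsConj.of_card hq hF).sub_pow, inv_pow, hαq, inv_inv, neg_sub]
    · refine (EAQ.codeOf_le_span hgm).trans (Submodule.span_mono ?_)
      rintro _ ⟨i, hi, rfl⟩
      exact ⟨EAQ.coeff_mem_codeOf hgm hi, EAQ.hammingNorm_coeff hδ hN hg hi⟩
  · push_cast; omega
  · intro hq13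
    -- The excluded case is `m = l = 1`, where `2d = 20` exceeds `n + 2 = 19`.
    have hm2 : 2 ≤ m := by
      by_contra! h
      apply hq13; omega
    have h1 : 2 * (2 * b + 2) ≤ n + 2 := by
      have : 2 * m ≤ m ^ 2 := by rw [sq]; exact Nat.mul_le_mul_right m hm2
      omega
    rw [le_div_iff₀ two_pos]
    exact_mod_cast (by omega : (2 * b + 2) * 2 ≤ n + 2)
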